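/- **Theorem (D).** Let $(a(n))_{n\in\mathbb Z}$ be a deterministic real sequence for which there is $M>0$ with $\frac1M\le |a(n)|\le M$ for all $n\in\mathbb Z$, and let $(\Delta_a u)(n)=a(n+1)u(n+1)+a(n)u(n-1)$. Let $V_\omega=(V_\omega(n))_{n\in\mathbb Z}$ be i.i.d. real random variables whose common law has a bounded, compactly supported density. For each $E\in\mathbb R$ fix real numbers $\lambda_E,\mu_E$, let $\sigma=\{E\in\mathbb R:\lambda_E\neq 0\}$ and, for $E\in\sigma$, let $V_\omega(E)=\frac{1}{\lambda_E}(V_\omega-\mu_E)$. For $l\in\mathbb N$ let $\Lambda_l=[1,l]\cap\mathbb Z$ and let $(-\Delta_a+V_\omega(E))_{\Lambda_l}$ be the restriction of $-\Delta_a+V_\omega(E)$ to $\ell^2(\Lambda_l)$ with Dirichlet boundary conditions. Let $\beta\in(1/2,1)$, $\alpha\in(0,1)$, and let $E,E'\in\sigma$ be such that at least two of the three numbers $$d=\lambda_E+\lambda_{E'},\qquad b=\lambda_E-\lambda_{E'},\qquad c=\mu_E-\mu_{E'}$$ are non-zero. Then for every $k>0$ there exists $C>0$ such that, for all sufficiently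 large $L\in\mathbb N$ and all $l\in\mathbb N$ with $kL^\alpha\le l\le L^\alpha/k$, $$\mathbb P\left(\begin{aligned}\operatorname{tr}\mathbf 1_{[-L^{-1},L^{-1}]}\big((-\Delta_a+V_\omega(E))_{\Lambda_l}\big)&\neq 0,\\ \operatorname{tr}\mathbf 1_{[-L^{-1},L^{-1}]}\big((-\Delta_a+V_\omega(E'))_{\Lambda_l}\big)&\neq 0\end{aligned}\right)\le C\,\frac{l^2}{L^{4/3}}\,e^{(\log L)^\beta}.$$ -/

import Mathlib

open MeasureTheory ProbabilityTheory Filter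

noncomputable section

namespace RandomJacobi

/-- The off-diagonal operator `(Δ_a u)(n) = a(n+1) u(n+1) + a(n) u(n-1)` on sequences on `ℤ`. -/
def hopping (a : ℤ → ℝ) (u : ℤ → ℝ) : ℤ → ℝ :=
  fun n => a (n + 1) * u (n + 1) + a n * u (n - 1)

/-- The Jacobi operator `-Δ_a + V` on sequences on `ℤ`. -/
def jacobiOp (a V : ℤ → ℝ) (u : ℤ → ℝ) : ℤ → ℝ :=
  fun n => -(hopping a u n) + V n * u n

/-- The box `Λ_l = [1, l] ∩ ℤ`. -/
abbrev Box (l : ℕ) : Type := ↥(Finset.Icc (1 : ℤ) (l : ℤ))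

/-- The restriction of `-Δ_a + V` to `ℓ²(Λ_l)` with Dirichlet boundary conditions, as a matrix in
the canonical basis `(δ_n)`: sequences on the box are extended by `0`, the operator is applied, and
the result is restricted to the box. -/
def boxOp (a V : ℤ → ℝ) (l : ℕ) : Matrix (Box l) (Box l) ℝ :=
  Matrix.of fun m n => jacobiOp a V (Pi.single (n : ℤ) 1) (m : ℤ)

theorem boxOp_isHermitian (a V : ℤ → ℝ) (l : ℕ) : (boxOp a V l).IsHermitian := by
  ext ⟨m, hm⟩ ⟨n, hn⟩
  simp only [boxOp, jacobiOp, hopping, Matrix.conjTranspose_apply, Matrix.of_apply, star_trivial,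
    Pi.single_apply]
  have e1 : (m - 1 = n) ↔ (n + 1 = m) := by omega
  have e2 : (n - 1 = m) ↔ (m + 1 = n) := by omega
  have e3 : (m = n) ↔ (n = m) := eq_comm
  simp only [e1, e2, e3]
  by_cases h1 : n + 1 = m
  · subst h1
    have h2 : ¬ (n + 1 + 1 = n) := by omega
    have h3 : ¬ (n = n + 1) := by omega
    simp [h2, h3]
  · by_cases h2 : m + 1 = n
    · subst h2
      have h3 : ¬ (m + 1 + 1 = m) := by omega
      simp [h3]
    · by_cases h3 : n = m
      · subst h3; simp
      · simp [h1, h2, h3]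

/-- `tr 1_J(H)` for `H` the restriction of `-Δ_a + V` to the box `Λ_l`: the trace of the spectral
projection of `H` onto `J`. -/
def trSpectralProj (a V : ℤ → ℝ) (l : ℕ) (J : Set ℝ) : ℝ :=
  ((boxOp_isHermitian a V l).cfc (J.indicator 1)).trace

/-- The set `σ = {E | λ_E ≠ 0}`. -/
def energySet (lam : ℝ → ℝ) : Set ℝ := {E | lam E ≠ 0}

/-- The rescaled potential `V(E) = (V - μ_E) / λ_E`. -/
def potentialAt (lam mu : ℝ → ℝ) (E : ℝ) (V : ℤ → ℝ) : ℤ → ℝ :=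
  fun n => (V n - mu E) / lam E

/-- At least two of three real numbers are non-zero. -/
def AtLeastTwoNonzero (x y z : ℝ) : Prop :=
  (x ≠ 0 ∧ y ≠ 0) ∨ (x ≠ 0 ∧ z ≠ 0) ∨ (y ≠ 0 ∧ z ≠ 0)

end RandomJacobi

end

/-! Multiplying by `lam E` turns an eigenvalue of `-Δ_a + V(E)` in `[-1/L, 1/L]` into an eigenvalue
of `-lam E • Δ_a + V` within `Λ/L` of `mu E`, where `Λ = max |lam E| |lam E'|`. So two matrices with
different hopping strengths share one random potential, and both must have an eigenvalue in a
prescribed window of size `O(1/L)`.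

If `α ≥ 1/3`, one matrix is enough: the Wegner bound `pi_eigenpair_le` gives `l log l / L`, the
lower bound on `l` turns `l / L` into a multiple of `l² / L^(4/3)`, and the exponential absorbs the
logarithm.

If `α < 1/3`, put `κ = L^(-γ)` with `γ = 1/3 - α`, and let `φ`, `φ'` be the normalized eigenvectors.
The gradients of the two eigenvalues with respect to the potential are `φ²` and `φ'²`. Suppose first
that these differ at some site by more than `κ² max φ² ≥ κ²/l`. Then at some pair of sites the
Jacobian of the two eigenvalues is at least `κ²/l²`, and averaging over these two sites
(`pi_eigenpair_pair_le`), followed by a union over `l²` pairs, gives `l² · (l²/κ²) · L⁻²`, which is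
of order `l² L^(-4/3)` by the choice of `γ`.

Otherwise `φ' = ±φ` up to `κ max |φ|`, with signs depending on the site. Subtracting the two
eigenvalue equations eliminates the potential and leaves an approximate recursion for `φ` with
coefficients `±lam' - lam` and `μ - μ'`. Combined with the eigenvalue equation it is overdetermined:
among any three consecutive sites near the maximum of `φ`, the potential is pinned at one up to
`O(κ)` (`IsChain.exists_constraint`). Each pinned site costs a factor `κ`, so a fixed number of them
beats `L^(-4/3)`, even after summing over the signs and a grid of initial data (`pi_isChain_le`).
The hypothesis on `d, b, c` enters here: if one of the coefficients `±lam' - lam` vanishes, then `μ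
- μ'` does not.

Averaging is done on the equation `det (K + V - E) = 0` itself (`addHaar_implicit_le`), so no
eigenvalue branches have to be selected or differentiated. -/

noncomputable section

namespace RandomJacobi

open scoped Topology ENNReal Matrix

variable {ι : Type*} [Fintype ι] [DecidableEq ι]

/-! ### Change of variables for implicitly defined maps -/

/-- The set of those `u` that solve `f (e, u) = 0` for some parameter `e ∈ R`, where the solution is
unique and transversal, has measure controlled by that of `R`. -/
theorem addHaar_implicit_le {F : Type*} [NormedAddCommGroup F] [NormedSpace ℝ F]
    [FiniteDimensional ℝ F] [MeasurableSpace F] [BorelSpace F] (ν : Measure F) [ν.IsAddHaarMeasure]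
    {f : F × F → F} (hf : ContDiff ℝ 1 f) {P : Set (F × F)} (hP : IsOpen P)
    (hdet : ∀ p ∈ P, (fderiv ℝ f p ∘L .inr ℝ F F).det ≠ 0)
    (huniq : ∀ e u u', (e, u) ∈ P → (e, u') ∈ P → f (e, u) = 0 → f (e, u') = 0 → u = u')
    {R : Set F} (hR : MeasurableSet R) {τ : ℝ} (hτ : 0 < τ) :
    ν {u | ∃ e ∈ R, (e, u) ∈ P ∧ f (e, u) = 0 ∧
      τ * |(fderiv ℝ f (e, u) ∘L .inl ℝ F F).det| ≤ |(fderiv ℝ f (e, u) ∘L .inr ℝ F F).det|}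
      ≤ ENNReal.ofReal τ⁻¹ * ν R := by
  classical
  have : CompleteSpace F := FiniteDimensional.complete ℝ F
  set U : Set F := {e | ∃ u, (e, u) ∈ P ∧ f (e, u) = 0} with hU
  let Ψ : F → F := fun e => if h : ∃ u, (e, u) ∈ P ∧ f (e, u) = 0 then h.choose else 0
  have hΨ : ∀ e ∈ U, (e, Ψ e) ∈ P ∧ f (e, Ψ e) = 0 := by
    intro e he
    have h : ∃ u, (e, u) ∈ P ∧ f (e, u) = 0 := he
    simp only [Ψ, dif_pos h]
    exact h.choose_spec
  have hinv : ∀ p ∈ P, (fderiv ℝ f p ∘L .inr ℝ F F).IsInvertible := fun p hp =>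
    ⟨ContinuousLinearMap.toContinuousLinearEquivOfDetNeZero _ (hdet p hp), by ext; rfl⟩
  have hloc : ∀ e ∈ U, U ∈ 𝓝 e ∧ HasFDerivAt Ψ
      (-(fderiv ℝ f (e, Ψ e) ∘L .inr ℝ F F).inverse ∘L (fderiv ℝ f (e, Ψ e) ∘L .inl ℝ F F)) e := by
    intro e he
    obtain ⟨hp, h0⟩ := hΨ e he
    have cdf : ContDiffAt ℝ 1 f (e, Ψ e) := hf.contDiffAt
    have if₂ := hinv _ hp
    have hder := cdf.hasStrictFDerivAt_implicitFunction one_ne_zero if₂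
    have hself := cdf.implicitFunction_apply_self one_ne_zero if₂
    have hev := cdf.eventually_apply_implicitFunction one_ne_zero if₂
    have hcont : Tendsto (fun x => (x, cdf.implicitFunction one_ne_zero if₂ x)) (𝓝 e)
        (𝓝 (e, Ψ e)) := by
      have h := (continuousAt_id.prodMk hder.continuousAt).tendsto
      simp only [id] at h
      rwa [hself] at h
    have hPev := hcont.eventually (hP.mem_nhds hp)
    -- `Ψ` is an arbitrary choice of solutions, but uniqueness forces it to agree near `e` with the
    -- implicit function, which makes it differentiable on `U`.
    have hboth : ∀ᶠ x in 𝓝 e, x ∈ U ∧ Ψ x = cdf.implicitFunction one_ne_zero if₂ x := by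
      filter_upwards [hev, hPev] with x hx1 hx2
      have hxU : x ∈ U := ⟨_, hx2, hx1.trans h0⟩
      exact ⟨hxU, huniq x _ _ (hΨ x hxU).1 hx2 (hΨ x hxU).2 (hx1.trans h0)⟩
    exact ⟨hboth.mono fun x hx => hx.1,
      hder.hasFDerivAt.congr_of_eventuallyEq (hboth.mono fun x hx => hx.2)⟩
  have hUo : IsOpen U := isOpen_iff_mem_nhds.2 fun e he => (hloc e he).1
  have hΨc : ContinuousOn Ψ U := fun e he => (hloc e he).2.continuousAt.continuousWithinAt
  have hfd : Continuous (fderiv ℝ f) := hf.continuous_fderiv one_ne_zero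
  have hdetc : Continuous (fun A : F →L[ℝ] F => A.det) := ContinuousLinearMap.continuous_det
  let g : F → ℝ := fun e => |(fderiv ℝ f (e, Ψ e) ∘L .inr ℝ F F).det| -
    τ * |(fderiv ℝ f (e, Ψ e) ∘L .inl ℝ F F).det|
  have hgc : ContinuousOn g U := by
    have h1 : ContinuousOn (fun e => fderiv ℝ f (e, Ψ e)) U :=
      hfd.comp_continuousOn (continuousOn_id.prodMk hΨc)
    have h2 : ∀ B : F →L[ℝ] F × F, ContinuousOn (fun e => (fderiv ℝ f (e, Ψ e) ∘L B).det) U :=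
      fun B => hdetc.comp_continuousOn (h1.clm_comp continuousOn_const)
    exact (h2 _).abs.sub (continuousOn_const.mul (h2 _).abs)
  have hopen : IsOpen (U ∩ g ⁻¹' Set.Iio 0) := hgc.isOpen_inter_preimage hUo isOpen_Iio
  -- On `T` the Jacobian of `Ψ`, a quotient of the two partial determinants, is at most `τ⁻¹`.
  -- Removing an open subset of `U` keeps `T` measurable.
  set T : Set F := R ∩ (U \ (U ∩ g ⁻¹' Set.Iio 0)) with hT
  have hTm : MeasurableSet T := hR.inter (hUo.measurableSet.diff hopen.measurableSet)
  have hTU : T ⊆ U := fun e he => he.2.1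
  calc _ ≤ ν (Ψ '' T) := by
        apply measure_mono
        rintro u ⟨e, heR, hep, he0, hle⟩
        have heU : e ∈ U := ⟨u, hep, he0⟩
        have hu : Ψ e = u := huniq e _ _ (hΨ e heU).1 hep (hΨ e heU).2 he0
        refine ⟨e, ⟨heR, heU, fun h => ?_⟩, hu⟩
        have h2 : g e < 0 := h.2
        simp only [g, hu] at h2
        linarith
    _ ≤ ∫⁻ x in T, ENNReal.ofReal |(-(fderiv ℝ f (x, Ψ x) ∘L .inr ℝ F F).inverse ∘L
          (fderiv ℝ f (x, Ψ x) ∘L .inl ℝ F F)).det| ∂ν :=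
        addHaar_image_le_lintegral_abs_det_fderiv ν hTm fun x hx =>
          (hloc x (hTU hx)).2.hasFDerivWithinAt
    _ ≤ ∫⁻ _ in T, ENNReal.ofReal τ⁻¹ ∂ν := by
        refine setLIntegral_mono' hTm fun x hx => ENNReal.ofReal_le_ofReal ?_
        have hgx : 0 ≤ g x := not_lt.1 fun h => hx.2.2 ⟨hTU hx, h⟩
        have hpx := (hΨ x (hTU hx)).1
        set Bm := fderiv ℝ f (x, Ψ x) ∘L .inr ℝ F F with hB
        set Am := fderiv ℝ f (x, Ψ x) ∘L .inl ℝ F F with hA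
        have hBd : Bm.det ≠ 0 := hdet _ hpx
        have hmul : Bm.inverse.det * Bm.det = 1 := by
          obtain ⟨Be, hBe⟩ := hinv _ hpx
          change (Be : F →L[ℝ] F) = Bm at hBe
          have h1 : Bm.inverse ∘L Bm = ContinuousLinearMap.id ℝ F := by
            rw [← hBe]; ext; simp
          have h2 : (Bm.inverse ∘L Bm).det = 1 := by
            rw [h1]; exact LinearMap.det_id
          rw [← h2]
          exact (LinearMap.det_comp (Bm.inverse : F →ₗ[ℝ] F) (Bm : F →ₗ[ℝ] F)).symm
        have hcomp : |(-Bm.inverse ∘L Am).det| = |Bm.inverse.det| * |Am.det| := by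
          have h3 : (-Bm.inverse ∘L Am).det
              = (-Bm.inverse).det * Am.det :=
            LinearMap.det_comp (((-Bm.inverse : F →L[ℝ] F)) : F →ₗ[ℝ] F) (Am : F →ₗ[ℝ] F)
          have h4 : |(-Bm.inverse).det| = |Bm.inverse.det| := by
            have : (((-Bm.inverse : F →L[ℝ] F)) : F →ₗ[ℝ] F)
                = (-1 : ℝ) • (Bm.inverse : F →ₗ[ℝ] F) := by ext; simp
            rw [ContinuousLinearMap.det, this, LinearMap.det_smul]
            simp [abs_mul, ContinuousLinearMap.det]
          rw [h3, abs_mul, h4]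
        rw [hcomp]
        have hinvabs : |Bm.inverse.det| = |Bm.det|⁻¹ := by
          refine eq_inv_of_mul_eq_one_left ?_
          rw [← abs_mul, hmul, abs_one]
        have hgx' : τ * |Am.det| ≤ |Bm.det| := by
          have : g x = |Bm.det| - τ * |Am.det| := rfl
          linarith
        rw [hinvabs, inv_mul_le_iff₀ (abs_pos.2 hBd), mul_comm, inv_mul_eq_div, le_div_iff₀ hτ]
        linarith
    _ = ENNReal.ofReal τ⁻¹ * ν T := by simp
    _ ≤ _ := by gcongr; exact Set.inter_subset_left

/-! ### The determinant as a function of the potential -/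

/-- All the kernels of the matrices `K + diag V` are at most one-dimensional. -/
def SimpleKernel (K : Matrix ι ι ℝ) : Prop :=
  ∀ V φ ψ : ι → ℝ, (K + Matrix.diagonal V) *ᵥ φ = 0 → (K + Matrix.diagonal V) *ᵥ ψ = 0 →
    ∀ i j, φ i * ψ j = φ j * ψ i

/-- The determinant of `K + diag V` as a function of `V`. -/
def potDet (K : Matrix ι ι ℝ) (V : ι → ℝ) : ℝ := (K + Matrix.diagonal V).det

theorem contDiff_potDet (K : Matrix ι ι ℝ) : ContDiff ℝ 1 (potDet K) := by
  unfold potDet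
  simp only [Matrix.det_apply, Matrix.add_apply, Matrix.diagonal_apply]
  refine ContDiff.sum fun σ _ => ContDiff.const_smul _ (contDiff_prod fun i _ => ?_)
  split_ifs
  · fun_prop
  · fun_prop

/-- The determinant is linear in row `n`, hence affine in the potential at `n`, with the principal
cofactor as slope. -/
theorem potDet_add_single (K : Matrix ι ι ℝ) (V : ι → ℝ) (n : ι) (t : ℝ) :
    potDet K (V + Pi.single n t) = potDet K V + t * (K + Matrix.diagonal V).adjugate n n := by
  unfold potDet
  have h : K + Matrix.diagonal (V + Pi.single n t) = (K + Matrix.diagonal V).updateRow n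
      ((K + Matrix.diagonal V) n + t • Pi.single n 1) := by
    ext i j
    by_cases hi : i = n
    · subst hi
      by_cases hj : i = j
      · subst hj; simp; ring
      · simp [hj, Ne.symm hj]
    · by_cases hj : i = j
      · subst hj; simp [hi, Matrix.updateRow_ne]
      · simp [hi, hj, Matrix.updateRow_ne]
  rw [h, Matrix.det_updateRow_add, Matrix.updateRow_eq_self, Matrix.det_updateRow_smul,
    Matrix.adjugate_apply]

theorem fderiv_potDet_single (K : Matrix ι ι ℝ) (V : ι → ℝ) (n : ι) :
    fderiv ℝ (potDet K) V (Pi.single n 1) = (K + Matrix.diagonal V).adjugate n n := by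
  have hd : HasFDerivAt (potDet K) (fderiv ℝ (potDet K) V) (V + (0 : ℝ) • Pi.single n (1 : ℝ)) := by
    simpa using ((contDiff_potDet K).differentiable one_ne_zero V).hasFDerivAt
  have hl : HasDerivAt (fun t : ℝ => V + t • (Pi.single n (1 : ℝ) : ι → ℝ)) (Pi.single n 1) 0 := by
    simpa using ((hasDerivAt_id (0 : ℝ)).smul_const (Pi.single n (1 : ℝ) : ι → ℝ)).const_add V
  have h1 := hd.comp_hasDerivAt (0 : ℝ) hl
  have h2 : HasDerivAt (fun t : ℝ => potDet K V + t * (K + Matrix.diagonal V).adjugate n n)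
      ((K + Matrix.diagonal V).adjugate n n) 0 := by
    simpa using ((hasDerivAt_id (0 : ℝ)).mul_const _).const_add (potDet K V)
  refine h1.unique (h2.congr_of_eventuallyEq (Eventually.of_forall fun t => ?_))
  simp only [Function.comp]
  rw [← potDet_add_single]
  congr 2
  ext i
  simp [Pi.single_apply]

theorem fderiv_potDet (K : Matrix ι ι ℝ) (V w : ι → ℝ) :
    fderiv ℝ (potDet K) V w = ∑ n, w n * (K + Matrix.diagonal V).adjugate n n := by
  conv_lhs => rw [pi_eq_sum_univ' w]
  rw [map_sum]
  refine Finset.sum_congr rfl fun n _ => ?_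
  rw [← fderiv_potDet_single, ← smul_eq_mul, ← map_smul]

/-- After diagonalization, a vanishing adjugate forces a second zero eigenvalue. The two orthonormal
kernel vectors would be proportional, which is equality in Cauchy–Schwarz and gives `1 = 0`. -/
theorem adjugate_ne_zero_of_simple {A : Matrix ι ι ℝ} (hA : A.IsHermitian)
    (hs : ∀ φ ψ : ι → ℝ, A *ᵥ φ = 0 → A *ᵥ ψ = 0 → ∀ i j, φ i * ψ j = φ j * ψ i)
    (hdet : A.det = 0) : A.adjugate ≠ 0 := by
  intro hadj
  have hU := hA.spectral_theorem
  have hprod : ∏ i, hA.eigenvalues i = 0 := by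
    have := hA.det_eq_prod_eigenvalues
    rw [hdet] at this
    simpa using this.symm
  obtain ⟨i, -, hi⟩ := Finset.prod_eq_zero_iff.1 hprod
  have hconj : Matrix.diagonal hA.eigenvalues =
      (star (hA.eigenvectorUnitary : Matrix ι ι ℝ)) * A * (hA.eigenvectorUnitary : Matrix ι ι ℝ) := by
    have := hA.conjStarAlgAut_star_eigenvectorUnitary
    rw [Unitary.conjStarAlgAut_star_apply] at this
    exact this.symm
  have h0 : (Matrix.diagonal hA.eigenvalues).adjugate = 0 := by
    rw [hconj, Matrix.adjugate_mul_distrib, Matrix.adjugate_mul_distrib, hadj]; simp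
  rw [Matrix.adjugate_diagonal] at h0
  have h1 := congrFun (congrFun h0 i) i
  simp only [Matrix.diagonal_apply_eq, Matrix.zero_apply] at h1
  obtain ⟨j, hj, hj0⟩ := Finset.prod_eq_zero_iff.1 h1
  have hji : j ≠ i := (Finset.mem_erase.1 hj).1
  have hvec : ∀ m, hA.eigenvalues m = 0 → A *ᵥ (hA.eigenvectorBasis m).ofLp = 0 := by
    intro m hm
    rw [hA.mulVec_eigenvectorBasis, hm, zero_smul]
  have hpar := hs _ _ (hvec i hi) (hvec j hj0)
  have horth : ∑ m, (hA.eigenvectorBasis i).ofLp m * (hA.eigenvectorBasis j).ofLp m = 0 := by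
    have := hA.eigenvectorBasis.orthonormal.2 hji
    simpa [PiLp.inner_apply, mul_comm] using this
  have hn : ∀ m, ∑ r, (hA.eigenvectorBasis m).ofLp r * (hA.eigenvectorBasis m).ofLp r = 1 := by
    intro m
    have := hA.eigenvectorBasis.orthonormal.1 m
    have h2 := EuclideanSpace.real_norm_sq_eq (hA.eigenvectorBasis m)
    rw [this] at h2
    simpa [pow_two] using h2.symm
  have : (1 : ℝ) = 0 := by
    calc (1 : ℝ) = (∑ r, (hA.eigenvectorBasis i).ofLp r * (hA.eigenvectorBasis i).ofLp r) *
          (∑ r, (hA.eigenvectorBasis j).ofLp r * (hA.eigenvectorBasis j).ofLp r) := by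
            rw [hn, hn, one_mul]
      _ = (∑ m, (hA.eigenvectorBasis i).ofLp m * (hA.eigenvectorBasis j).ofLp m) *
          (∑ m, (hA.eigenvectorBasis i).ofLp m * (hA.eigenvectorBasis j).ofLp m) := by
            rw [Finset.sum_mul_sum, Finset.sum_mul_sum]
            refine Finset.sum_congr rfl fun a _ => Finset.sum_congr rfl fun b _ => ?_
            linear_combination (hA.eigenvectorBasis i).ofLp a * (hA.eigenvectorBasis j).ofLp b * hpar a b
      _ = 0 := by rw [horth, zero_mul]
  exact one_ne_zero this

/-- The adjugate of a singular symmetric matrix with simple kernel is a non-zero multiple of the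
projection onto the kernel. -/
theorem exists_adjugate_eq {A : Matrix ι ι ℝ} (hA : A.IsHermitian)
    (hs : ∀ φ ψ : ι → ℝ, A *ᵥ φ = 0 → A *ᵥ ψ = 0 → ∀ i j, φ i * ψ j = φ j * ψ i)
    {φ : ι → ℝ} (hφ : A *ᵥ φ = 0) (hφ1 : ∑ i, φ i ^ 2 = 1) :
    A.det = 0 ∧ ∃ c : ℝ, c ≠ 0 ∧ ∀ i j, A.adjugate i j = c * (φ i * φ j) := by
  have hne : φ ≠ 0 := by rintro rfl; simp at hφ1
  have hdet : A.det = 0 := Matrix.exists_mulVec_eq_zero_iff.1 ⟨φ, hne, hφ⟩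
  refine ⟨hdet, ?_⟩
  have hcol : ∀ j, A *ᵥ (fun i => A.adjugate i j) = 0 := by
    intro j
    ext i
    have := congrFun (congrFun (Matrix.mul_adjugate A) i) j
    simpa [hdet, Matrix.mul_apply, Matrix.mulVec, dotProduct] using this
  have hsymm : ∀ i j, A.adjugate i j = A.adjugate j i := by
    intro i j
    have h := Matrix.adjugate_transpose A
    have hT : Aᵀ = A := by simpa [Matrix.IsHermitian] using hA
    rw [hT] at h
    exact (congrFun (congrFun h j) i)
  have hpar : ∀ i j k, φ i * A.adjugate k j = φ k * A.adjugate i j := fun i j k =>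
    hs _ _ hφ (hcol j) i k
  -- The columns of the adjugate lie in the kernel, and by symmetry so do its rows. Hence it is
  -- determined by its contraction with `φ` on both sides, which is the constant `c`.
  have key : ∀ i j, A.adjugate i j = (∑ a, ∑ b, φ a * φ b * A.adjugate a b) * (φ i * φ j) := by
    intro i j
    calc A.adjugate i j = (∑ a, φ a ^ 2) * (∑ b, φ b ^ 2) * A.adjugate i j := by rw [hφ1]; ring
      _ = _ := by
        rw [Finset.sum_mul_sum, Finset.sum_mul, Finset.sum_mul]
        refine Finset.sum_congr rfl fun a _ => ?_
        rw [Finset.sum_mul, Finset.sum_mul]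
        refine Finset.sum_congr rfl fun b _ => ?_
        have e1 := hpar a j i
        have e2 := hpar b a j
        rw [hsymm j a, hsymm b a] at e2
        linear_combination φ a * φ b ^ 2 * e1 + φ a * φ b * φ i * e2
  refine ⟨_, ?_, key⟩
  intro h0
  apply adjugate_ne_zero_of_simple hA hs hdet
  ext i j
  rw [key, h0]; simp

/-- `φ` is a normalized eigenvector of `K + diag V` at the energy `E`. -/
def IsEigenpair (K : Matrix ι ι ℝ) (V : ι → ℝ) (E : ℝ) (φ : ι → ℝ) : Prop :=
  (K + Matrix.diagonal V) *ᵥ φ = E • φ ∧ ∑ i, φ i ^ 2 = 1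

/-- The Feynman–Hellmann formula without eigenvalue branches: the gradient of the determinant is the
diagonal of the adjugate, a non-zero multiple of `φ²`. The unknown factor `c` cancels in quotients
of derivatives. -/
theorem IsEigenpair.fderiv_potDet {K : Matrix ι ι ℝ} (hK : K.IsHermitian) (hs : SimpleKernel K)
    {V φ : ι → ℝ} {E : ℝ} (h : IsEigenpair K V E φ) :
    potDet K (V - fun _ => E) = 0 ∧ ∃ c : ℝ, c ≠ 0 ∧
      ∀ w, fderiv ℝ (potDet K) (V - fun _ => E) w = c * ∑ n, w n * φ n ^ 2 := by
  have h0 : (K + Matrix.diagonal (V - fun _ => E)) *ᵥ φ = 0 := by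
    have h1 := h.1
    ext i
    have h2 := congrFun h1 i
    simp only [Matrix.add_mulVec, Matrix.mulVec_diagonal, Pi.add_apply, Pi.sub_apply, Pi.smul_apply,
      smul_eq_mul, Pi.zero_apply] at h2 ⊢
    linarith
  have hherm : (K + Matrix.diagonal (V - fun _ => E)).IsHermitian :=
    hK.add (Matrix.isHermitian_diagonal _)
  obtain ⟨hd, c, hc, hadj⟩ := exists_adjugate_eq hherm (hs _) h0 h.2
  refine ⟨hd, c, hc, fun w => ?_⟩
  rw [RandomJacobi.fderiv_potDet, Finset.mul_sum]
  refine Finset.sum_congr rfl fun n _ => ?_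
  rw [hadj]; ring

/-! ### Spectral averaging over one and two sites -/

theorem det_clm_real (A : ℝ →L[ℝ] ℝ) : A.det = A 1 := by
  simp [ContinuousLinearMap.det, LinearMap.det_ring]

theorem det_clm_real_prod (A : ℝ × ℝ →L[ℝ] ℝ × ℝ) :
    A.det = (A (1, 0)).1 * (A (0, 1)).2 - (A (0, 1)).1 * (A (1, 0)).2 := by
  rw [ContinuousLinearMap.det, ← LinearMap.det_toMatrix (Module.Basis.finTwoProd ℝ),
    Matrix.det_fin_two]
  simp [LinearMap.toMatrix_apply]

theorem update_eq_add_smul_single {κ : Type*} [DecidableEq κ] (v : κ → ℝ) (n : κ) (x : ℝ) :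
    Function.update v n x = Function.update v n 0 + x • Pi.single n 1 := by
  ext i
  by_cases h : i = n
  · subst h; simp
  · simp [h]

theorem smul_single_one {κ : Type*} [DecidableEq κ] (n : κ) (x : ℝ) : x • (Pi.single n 1 : κ → ℝ) = Pi.single n x := by
  rw [← Pi.single_smul]; simp

/-- Spectral averaging over one site. -/
theorem volume_eigenpair_slice_le {K : Matrix ι ι ℝ} (hK : K.IsHermitian) (hs : SimpleKernel K)
    (v : ι → ℝ) (n : ι) {I : Set ℝ} (hI : MeasurableSet I) {t : ℝ} (ht : 0 < t) :
    volume {x : ℝ | ∃ E ∈ I, ∃ φ, IsEigenpair K (Function.update v n x) E φ ∧ t ≤ φ n ^ 2}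
      ≤ ENNReal.ofReal t⁻¹ * volume I := by
  let w : ℝ × ℝ → ι → ℝ := fun p => (Function.update v n 0 + p.2 • Pi.single n 1) - fun _ => p.1
  let w' : ℝ × ℝ →L[ℝ] (ι → ℝ) := (ContinuousLinearMap.snd ℝ ℝ ℝ).smulRight (Pi.single n 1) -
    (ContinuousLinearMap.fst ℝ ℝ ℝ).smulRight (1 : ι → ℝ)
  have hw : w = fun p => Function.update v n 0 + w' p := by
    ext p i; simp [w, w']; ring
  have hwc : ContDiff ℝ 1 w := by rw [hw]; fun_prop
  have hwd : ∀ p, HasFDerivAt w w' p := by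
    intro p; rw [hw]; exact w'.hasFDerivAt.const_add _
  let f : ℝ × ℝ → ℝ := fun p => potDet K (w p)
  have hf : ContDiff ℝ 1 f := (contDiff_potDet K).comp hwc
  have hfd : ∀ p q, fderiv ℝ f p q = fderiv ℝ (potDet K) (w p) (w' q) := by
    intro p q
    have := (((contDiff_potDet K).differentiable one_ne_zero (w p)).hasFDerivAt.comp p (hwd p)).fderiv
    exact congrArg (fun A => A q) this
  have hw1 : w' (0, 1) = Pi.single n 1 := by ext i; simp [w']
  have hw0 : w' (1, 0) = fun _ => -1 := by ext i; simp [w']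
  -- The energy is the parameter and the potential at `n` the unknown. The partial derivatives are
  -- `-c` and `c * φ n ^ 2`, so transversality with constant `t` is the condition `t ≤ φ n ^ 2`.
  have key := addHaar_implicit_le (volume : Measure ℝ) hf
    (P := {p | fderiv ℝ f p (0, 1) ≠ 0})
    (((hf.continuous_fderiv one_ne_zero).clm_apply continuous_const).isOpen_preimage _
      isOpen_ne) (fun p hp => by rw [det_clm_real]; simpa using hp) ?_ hI ht
  · refine (measure_mono ?_).trans key
    rintro x ⟨E, hE, φ, hφ, hle⟩
    rw [update_eq_add_smul_single] at hφ
    obtain ⟨h0, c, hc, hder⟩ := hφ.fderiv_potDet hK hs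
    have e1 : fderiv ℝ f (E, x) (0, 1) = c * φ n ^ 2 := by
      rw [hfd, hw1]
      exact (hder _).trans (by simp [Pi.single_apply])
    have e0 : fderiv ℝ f (E, x) (1, 0) = -c := by
      rw [hfd, hw0]
      refine (hder _).trans ?_
      simp [hφ.2]
    refine ⟨E, hE, ?_, h0, ?_⟩
    · rw [Set.mem_ofPred_eq, e1]
      exact mul_ne_zero hc (ht.trans_le hle).ne'
    · rw [det_clm_real, det_clm_real]
      simp only [ContinuousLinearMap.comp_apply, ContinuousLinearMap.inl_apply,
        ContinuousLinearMap.inr_apply, e0, e1, abs_neg, abs_mul]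
      rw [mul_comm, abs_of_nonneg (sq_nonneg (φ n))]
      gcongr
  -- Uniqueness holds because the equation is affine in the unknown with non-zero slope.
  · intro E u u' hu _ h1 h2
    have e1 : f (E, u') = f (E, u) + (u' - u) * fderiv ℝ f (E, u) (0, 1) := by
      rw [hfd, hw1, fderiv_potDet_single, ← potDet_add_single]
      refine congrArg (potDet K) (funext fun i => ?_)
      by_cases h : i = n
      · subst h; simp [w]
      · simp [w, h]
    rw [h1, h2] at e1
    rcases mul_eq_zero.1 (by linarith : (u' - u) * fderiv ℝ f (E, u) (0, 1) = 0) with h | h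
    · linarith
    · exact absurd h hu

theorem potDet_bilinear (K : Matrix ι ι ℝ) (V : ι → ℝ) (n m : ι) :
    ∃ A B C D : ℝ, ∀ x y : ℝ,
      potDet K (V + x • Pi.single n 1 + y • Pi.single m 1) = A * x * y + B * x + C * y + D := by
  let g : ℝ → ℝ → ℝ := fun x y => potDet K (V + x • Pi.single n 1 + y • Pi.single m 1)
  have aff : ∀ (W : ι → ℝ) (j : ι) (t : ℝ), potDet K (W + t • Pi.single j 1) =
      potDet K W + t * (potDet K (W + Pi.single j 1) - potDet K W) := by
    intro W j t
    rw [smul_single_one, potDet_add_single, potDet_add_single]; ring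
  have hy : ∀ x y, g x y = g x 0 + y * (g x 1 - g x 0) := by
    intro x y
    simpa [g] using aff (V + x • Pi.single n 1) m y
  have hx : ∀ x y, g x y = g 0 y + x * (g 1 y - g 0 y) := by
    intro x y
    have := aff (V + y • Pi.single m 1) n x
    simp only [g, zero_smul, one_smul, add_zero]
    rw [add_right_comm, this, add_right_comm V (Pi.single n 1)]
  refine ⟨g 1 1 - g 1 0 - g 0 1 + g 0 0, g 1 0 - g 0 0, g 0 1 - g 0 0, g 0 0, fun x y => ?_⟩
  change g x y = _
  rw [hy x y, hx x 0, hx x 1]; ring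

/-- Eliminating `y` leaves a polynomial of degree at most two in `x`, whose derivative at a solution
is minus the Jacobian. The derivatives at two distinct roots add up to zero, so the Jacobians cannot
have the same strict sign. If the `x` agree and the `y` do not, the Jacobian vanishes. -/
theorem bilinear_system_unique {A B C D A' B' C' D' x₁ y₁ x₂ y₂ : ℝ}
    (h1 : A * x₁ * y₁ + B * x₁ + C * y₁ + D = 0) (h1' : A' * x₁ * y₁ + B' * x₁ + C' * y₁ + D' = 0)
    (h2 : A * x₂ * y₂ + B * x₂ + C * y₂ + D = 0) (h2' : A' * x₂ * y₂ + B' * x₂ + C' * y₂ + D' = 0)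
    {σ : ℝ}
    (hJ1 : 0 < σ * ((A * y₁ + B) * (A' * x₁ + C') - (A * x₁ + C) * (A' * y₁ + B')))
    (hJ2 : 0 < σ * ((A * y₂ + B) * (A' * x₂ + C') - (A * x₂ + C) * (A' * y₂ + B'))) :
    x₁ = x₂ ∧ y₁ = y₂ := by
  have q1 : (A * x₁ + C) * (B' * x₁ + D') - (A' * x₁ + C') * (B * x₁ + D) = 0 := by
    linear_combination (A * x₁ + C) * h1' - (A' * x₁ + C') * h1
  have q2 : (A * x₂ + C) * (B' * x₂ + D') - (A' * x₂ + C') * (B * x₂ + D) = 0 := by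
    linear_combination (A * x₂ + C) * h2' - (A' * x₂ + C') * h2
  have hsum : (x₂ - x₁) * (((A * y₁ + B) * (A' * x₁ + C') - (A * x₁ + C) * (A' * y₁ + B')) +
      ((A * y₂ + B) * (A' * x₂ + C') - (A * x₂ + C) * (A' * y₂ + B'))) = 0 := by
    linear_combination (x₂ - x₁) * (A * h1' - A' * h1 + A * h2' - A' * h2) - 2 * (q2 - q1)
  have hx : x₁ = x₂ := by
    rcases mul_eq_zero.1 hsum with h | h
    · linarith
    · exfalso
      have : σ * (((A * y₁ + B) * (A' * x₁ + C') - (A * x₁ + C) * (A' * y₁ + B')) +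
        ((A * y₂ + B) * (A' * x₂ + C') - (A * x₂ + C) * (A' * y₂ + B'))) = 0 := by rw [h, mul_zero]
      linarith
  refine ⟨hx, ?_⟩
  subst hx
  by_contra hy
  have hy' : y₂ - y₁ ≠ 0 := fun h => hy (by linarith)
  have e1 : A * x₁ + C = 0 := by
    apply mul_left_cancel₀ hy'; linear_combination h2 - h1
  have e2 : A' * x₁ + C' = 0 := by
    apply mul_left_cancel₀ hy'; linear_combination h2' - h1'
  rw [e1, e2] at hJ1
  simp at hJ1

theorem fderiv_potDet_single_eq_sub (K : Matrix ι ι ℝ) (V : ι → ℝ) (n : ι) :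
    fderiv ℝ (potDet K) V (Pi.single n 1) = potDet K (V + Pi.single n 1) - potDet K V := by
  rw [fderiv_potDet_single, potDet_add_single]; ring

theorem update_update_eq_add_smul_single {κ : Type*} [DecidableEq κ] (v : κ → ℝ) {n m : κ} (hnm : n ≠ m) (x y : ℝ) :
    Function.update (Function.update v n x) m y =
      Function.update (Function.update v n 0) m 0 + x • Pi.single n 1 + y • Pi.single m 1 := by
  ext i
  by_cases h : i = m
  · subst h; simp [hnm.symm]
  · by_cases h' : i = n
    · subst h'; simp [h]
    · simp [h, h']

/-- Spectral averaging over two sites for a pair of operators with the same potential: the pairs of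
values of the potential at two sites for which both operators have an eigenvalue in given sets, with
a transversality condition on the eigenvectors. -/
theorem volume_eigenpair_pair_slice_le {K K' : Matrix ι ι ℝ} (hK : K.IsHermitian)
    (hK' : K'.IsHermitian) (hs : SimpleKernel K) (hs' : SimpleKernel K')
    (v : ι → ℝ) {n m : ι} (hnm : n ≠ m) {I I' : Set ℝ} (hI : MeasurableSet I)
    (hI' : MeasurableSet I') {τ : ℝ} (hτ : 0 < τ) :
    volume {x : ℝ × ℝ | ∃ E ∈ I, ∃ E' ∈ I', ∃ φ φ' : ι → ℝ,
        IsEigenpair K (Function.update (Function.update v n x.1) m x.2) E φ ∧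
        IsEigenpair K' (Function.update (Function.update v n x.1) m x.2) E' φ' ∧
        τ ≤ |φ n ^ 2 * φ' m ^ 2 - φ m ^ 2 * φ' n ^ 2|}
      ≤ 2 * (ENNReal.ofReal τ⁻¹ * (volume I * volume I')) := by
  set v0 : ι → ℝ := Function.update (Function.update v n 0) m 0 with hv0
  let w (pr : ℝ × ℝ →L[ℝ] ℝ) : (ℝ × ℝ) × (ℝ × ℝ) → ι → ℝ := fun p =>
    (v0 + p.2.1 • Pi.single n 1 + p.2.2 • Pi.single m 1) - fun _ => pr p.1
  let w' (pr : ℝ × ℝ →L[ℝ] ℝ) : (ℝ × ℝ) × (ℝ × ℝ) →L[ℝ] (ι → ℝ) :=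
    (ContinuousLinearMap.fst ℝ ℝ ℝ ∘L ContinuousLinearMap.snd ℝ (ℝ × ℝ) (ℝ × ℝ)).smulRight
        (Pi.single n 1) +
      (ContinuousLinearMap.snd ℝ ℝ ℝ ∘L ContinuousLinearMap.snd ℝ (ℝ × ℝ) (ℝ × ℝ)).smulRight
        (Pi.single m 1) -
      (pr ∘L ContinuousLinearMap.fst ℝ (ℝ × ℝ) (ℝ × ℝ)).smulRight (1 : ι → ℝ)
  have hw : ∀ pr, w pr = fun p => v0 + w' pr p := by
    intro pr; ext p i; simp [w, w']; ring
  have hwc : ∀ pr, ContDiff ℝ 1 (w pr) := by intro pr; rw [hw]; fun_prop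
  have hwd : ∀ pr p, HasFDerivAt (w pr) (w' pr) p := by
    intro pr p; rw [hw]; exact (w' pr).hasFDerivAt.const_add _
  set p₁ := ContinuousLinearMap.fst ℝ ℝ ℝ with hp₁
  set p₂ := ContinuousLinearMap.snd ℝ ℝ ℝ with hp₂
  let f : (ℝ × ℝ) × (ℝ × ℝ) → ℝ × ℝ := fun p => (potDet K (w p₁ p), potDet K' (w p₂ p))
  have hf : ContDiff ℝ 1 f :=
    ((contDiff_potDet K).comp (hwc _)).prodMk ((contDiff_potDet K').comp (hwc _))
  have hfd : ∀ p q, fderiv ℝ f p q = (fderiv ℝ (potDet K) (w p₁ p) (w' p₁ q),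
      fderiv ℝ (potDet K') (w p₂ p) (w' p₂ q)) := by
    intro p q
    have h1 := ((contDiff_potDet K).differentiable one_ne_zero (w p₁ p)).hasFDerivAt.comp p
      (hwd p₁ p)
    have h2 := ((contDiff_potDet K').differentiable one_ne_zero (w p₂ p)).hasFDerivAt.comp p
      (hwd p₂ p)
    exact congrArg (fun A => A q) (h1.prodMk h2).fderiv
  have hwn : ∀ pr, w' pr (0, (1, 0)) = Pi.single n 1 := by intro pr; ext i; simp [w']
  have hwm : ∀ pr, w' pr (0, (0, 1)) = Pi.single m 1 := by intro pr; ext i; simp [w']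
  have hw10 : ∀ pr, w' pr ((1, 0), 0) = fun _ => - pr (1, 0) := by intro pr; ext i; simp [w']
  have hw01 : ∀ pr, w' pr ((0, 1), 0) = fun _ => - pr (0, 1) := by intro pr; ext i; simp [w']
  have hinr : ∀ p, (fderiv ℝ f p ∘L .inr ℝ (ℝ × ℝ) (ℝ × ℝ)).det =
      fderiv ℝ (potDet K) (w p₁ p) (Pi.single n 1) * fderiv ℝ (potDet K') (w p₂ p) (Pi.single m 1) -
      fderiv ℝ (potDet K) (w p₁ p) (Pi.single m 1) *
        fderiv ℝ (potDet K') (w p₂ p) (Pi.single n 1) := by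
    intro p
    rw [det_clm_real_prod]
    simp only [ContinuousLinearMap.comp_apply, ContinuousLinearMap.inr_apply, hfd, hwn, hwm]
  have hinl : ∀ p, (fderiv ℝ f p ∘L .inl ℝ (ℝ × ℝ) (ℝ × ℝ)).det =
      fderiv ℝ (potDet K) (w p₁ p) (fun _ => -1) * fderiv ℝ (potDet K') (w p₂ p) (fun _ => -1) := by
    intro p
    rw [det_clm_real_prod]
    have hz : ∀ A : (ι → ℝ) →L[ℝ] ℝ, A (fun _ => 0) = 0 := fun A => map_zero A
    simp only [ContinuousLinearMap.comp_apply, ContinuousLinearMap.inl_apply, hfd, hw10, hw01]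
    simp [hp₁, hp₂, hz]
  have huniq : ∀ σ : ℝ, ∀ e u u' : ℝ × ℝ,
      0 < σ * (fderiv ℝ f (e, u) ∘L .inr ℝ (ℝ × ℝ) (ℝ × ℝ)).det →
      0 < σ * (fderiv ℝ f (e, u') ∘L .inr ℝ (ℝ × ℝ) (ℝ × ℝ)).det →
      f (e, u) = 0 → f (e, u') = 0 → u = u' := by
    rintro σ e ⟨x, y⟩ ⟨x', y'⟩ hu hu' h h'
    obtain ⟨A, B, C, D, hb⟩ := potDet_bilinear K (v0 - fun _ => e.1) n m
    obtain ⟨A', B', C', D', hb'⟩ := potDet_bilinear K' (v0 - fun _ => e.2) n m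
    have hwv : ∀ pr (x y : ℝ), w pr (e, (x, y)) =
        (v0 - fun _ => pr e) + x • Pi.single n 1 + y • Pi.single m 1 := by
      intro pr x y; ext i; simp [w]; ring
    have hwvn : ∀ pr (x y : ℝ), w pr (e, (x, y)) + Pi.single n 1 =
        (v0 - fun _ => pr e) + (x + 1) • Pi.single n 1 + y • Pi.single m 1 := by
      intro pr x y; ext i; simp [w]; ring
    have hwvm : ∀ pr (x y : ℝ), w pr (e, (x, y)) + Pi.single m 1 =
        (v0 - fun _ => pr e) + x • Pi.single n 1 + (y + 1) • Pi.single m 1 := by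
      intro pr x y; ext i; simp [w]; ring
    have g1 : ∀ x y, potDet K (w p₁ (e, (x, y))) = A * x * y + B * x + C * y + D := by
      intro x y; rw [hwv]; exact hb x y
    have g2 : ∀ x y, potDet K' (w p₂ (e, (x, y))) = A' * x * y + B' * x + C' * y + D' := by
      intro x y; rw [hwv]; exact hb' x y
    have d1n : ∀ x y, fderiv ℝ (potDet K) (w p₁ (e, (x, y))) (Pi.single n 1) = A * y + B := by
      intro x y; rw [fderiv_potDet_single_eq_sub, g1, hwvn]
      exact (congrArg (· - _) (hb (x + 1) y)).trans (by ring)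
    have d1m : ∀ x y, fderiv ℝ (potDet K) (w p₁ (e, (x, y))) (Pi.single m 1) = A * x + C := by
      intro x y; rw [fderiv_potDet_single_eq_sub, g1, hwvm]
      exact (congrArg (· - _) (hb x (y + 1))).trans (by ring)
    have d2n : ∀ x y, fderiv ℝ (potDet K') (w p₂ (e, (x, y))) (Pi.single n 1) = A' * y + B' := by
      intro x y; rw [fderiv_potDet_single_eq_sub, g2, hwvn]
      exact (congrArg (· - _) (hb' (x + 1) y)).trans (by ring)
    have d2m : ∀ x y, fderiv ℝ (potDet K') (w p₂ (e, (x, y))) (Pi.single m 1) = A' * x + C' := by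
      intro x y; rw [fderiv_potDet_single_eq_sub, g2, hwvm]
      exact (congrArg (· - _) (hb' x (y + 1))).trans (by ring)
    rw [hinr, d1n, d1m, d2n, d2m] at hu hu'
    simp only [f, Prod.mk_eq_zero, g1, g2] at h h'
    obtain ⟨hx, hy⟩ := bilinear_system_unique h.1 h.2 h'.1 h'.2 hu hu'
    rw [hx, hy]
  -- The bilinear system may have two transversal solutions, with Jacobians of opposite signs.
  -- Treating each sign separately restores uniqueness and costs the factor `2`.
  have key := fun σ : ℝ => addHaar_implicit_le (volume : Measure (ℝ × ℝ)) hf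
    (P := {p | 0 < σ * (fderiv ℝ f p ∘L .inr ℝ (ℝ × ℝ) (ℝ × ℝ)).det})
    (isOpen_lt continuous_const (continuous_const.mul (ContinuousLinearMap.continuous_det.comp
      ((hf.continuous_fderiv one_ne_zero).clm_comp continuous_const))))
    (fun p hp h0 => by rw [Set.mem_ofPred_eq, h0, mul_zero] at hp; exact lt_irrefl _ hp)
    (huniq σ) (hI.prod hI') hτ
  refine (measure_mono ?_).trans ((measure_union_le _ _).trans
    ((add_le_add (key 1) (key (-1))).trans_eq ?_))
  · rintro ⟨x, y⟩ ⟨E, hE, E', hE', φ, φ', hφ, hφ', hle⟩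
    simp only at hφ hφ'
    rw [update_update_eq_add_smul_single v hnm] at hφ hφ'
    obtain ⟨h0, c, hc, hder⟩ := hφ.fderiv_potDet hK hs
    obtain ⟨h0', c', hc', hder'⟩ := hφ'.fderiv_potDet hK' hs'
    have hder1 : ∀ W, fderiv ℝ (potDet K) (w p₁ ((E, E'), (x, y))) W = c * ∑ n, W n * φ n ^ 2 := hder
    have hder2 : ∀ W, fderiv ℝ (potDet K') (w p₂ ((E, E'), (x, y))) W = c' * ∑ n, W n * φ' n ^ 2 :=
      hder'
    have hfz : f ((E, E'), (x, y)) = 0 := Prod.ext h0 h0'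
    have eR : (fderiv ℝ f ((E, E'), (x, y)) ∘L .inr ℝ (ℝ × ℝ) (ℝ × ℝ)).det =
        c * c' * (φ n ^ 2 * φ' m ^ 2 - φ m ^ 2 * φ' n ^ 2) := by
      rw [hinr, hder1, hder1, hder2, hder2]
      simp [Pi.single_apply]; ring
    have eL : (fderiv ℝ f ((E, E'), (x, y)) ∘L .inl ℝ (ℝ × ℝ) (ℝ × ℝ)).det = c * c' := by
      rw [hinl, hder1, hder2]
      simp [hφ.2, hφ'.2]
    have hJ : (fderiv ℝ f ((E, E'), (x, y)) ∘L .inr ℝ (ℝ × ℝ) (ℝ × ℝ)).det ≠ 0 := by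
      rw [eR]
      exact mul_ne_zero (mul_ne_zero hc hc') (abs_pos.1 (hτ.trans_le hle))
    have hle' : τ * |(fderiv ℝ f ((E, E'), (x, y)) ∘L .inl ℝ (ℝ × ℝ) (ℝ × ℝ)).det| ≤
        |(fderiv ℝ f ((E, E'), (x, y)) ∘L .inr ℝ (ℝ × ℝ) (ℝ × ℝ)).det| := by
      rw [eR, eL, abs_mul (c * c'), mul_comm]
      gcongr
    rcases lt_or_gt_of_ne hJ with h | h
    · right
      exact ⟨(E, E'), ⟨hE, hE'⟩, by rw [Set.mem_ofPred_eq]; linarith, hfz, hle'⟩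
    · left
      exact ⟨(E, E'), ⟨hE, hE'⟩, by rw [Set.mem_ofPred_eq]; linarith, hfz, hle'⟩
  · rw [Measure.volume_eq_prod, Measure.prod_prod, two_mul]

/-! ### Measurability, and integration of slices over a product measure -/

/-- Energies in a compact interval and unit vectors range over compact sets, so projecting them away
keeps the eigenpair events closed, in particular measurable. -/
theorem isClosed_exists_mem_compact {X Y : Type*} [TopologicalSpace X] [TopologicalSpace Y]
    {C : Set Y} (hC : IsCompact C) {Z : Set (X × Y)} (hZ : IsClosed Z) :
    IsClosed {x | ∃ y ∈ C, (x, y) ∈ Z} := by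
  have : CompactSpace C := isCompact_iff_compactSpace.1 hC
  have h : {x | ∃ y ∈ C, (x, y) ∈ Z} =
      Prod.fst '' ((fun p : X × C => (p.1, (p.2 : Y))) ⁻¹' Z) := by
    ext x
    constructor
    · rintro ⟨y, hy, hxy⟩
      exact ⟨(x, ⟨y, hy⟩), hxy, rfl⟩
    · rintro ⟨⟨x', y⟩, hxy, rfl⟩
      exact ⟨y, y.2, hxy⟩
  rw [h]
  exact isClosedMap_fst_of_compactSpace _ (hZ.preimage (by fun_prop))

theorem isCompact_unit_sphere_sum {κ : Type*} [Fintype κ] : IsCompact {φ : κ → ℝ | ∑ i, φ i ^ 2 = 1} := by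
  refine Metric.isCompact_of_isClosed_isBounded
    (isClosed_eq (by fun_prop) continuous_const) ?_
  refine (Metric.isBounded_closedBall (x := (0 : κ → ℝ)) (r := 1)).subset fun φ hφ => ?_
  rw [mem_closedBall_zero_iff, pi_norm_le_iff_of_nonneg zero_le_one]
  intro i
  rw [Real.norm_eq_abs, ← sq_le_one_iff_abs_le_one]
  calc φ i ^ 2 ≤ ∑ j, φ j ^ 2 :=
        Finset.single_le_sum (f := fun j => φ j ^ 2) (fun j _ => sq_nonneg _) (Finset.mem_univ i)
    _ = 1 := hφ

theorem isClosed_isEigenpair {X : Type*} [TopologicalSpace X] (K : Matrix ι ι ℝ)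
    {V φ : X → ι → ℝ} {E : X → ℝ} (hV : Continuous V) (hφ : Continuous φ) (hE : Continuous E) :
    IsClosed {x | IsEigenpair K (V x) (E x) (φ x)} := by
  have : {x | IsEigenpair K (V x) (E x) (φ x)} =
      {x | (K + Matrix.diagonal (V x)) *ᵥ φ x = E x • φ x} ∩ {x | ∑ i, φ x i ^ 2 = 1} := rfl
  rw [this]
  exact (isClosed_eq ((continuous_const.add hV.matrix_diagonal).matrix_mulVec hφ)
    (hE.smul hφ)).inter (isClosed_eq (by fun_prop) continuous_const)

theorem isClosed_eigenpair_set (K : Matrix ι ι ℝ) (a b t : ℝ) (n : ι) :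
    IsClosed {V : ι → ℝ | ∃ E ∈ Set.Icc a b, ∃ φ, IsEigenpair K V E φ ∧ t ≤ φ n ^ 2} := by
  have hZ : IsClosed {p : (ι → ℝ) × (ℝ × (ι → ℝ)) | IsEigenpair K p.1 p.2.1 p.2.2 ∧
      t ≤ p.2.2 n ^ 2} :=
    (isClosed_isEigenpair K (V := fun p : (ι → ℝ) × (ℝ × (ι → ℝ)) => p.1) (φ := fun p => p.2.2)
      (E := fun p => p.2.1) (by fun_prop) (by fun_prop) (by fun_prop)).inter
      (isClosed_le (f := fun _ => t) (g := fun p : (ι → ℝ) × (ℝ × (ι → ℝ)) => p.2.2 n ^ 2) continuous_const (by fun_prop))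
  convert isClosed_exists_mem_compact
    ((isCompact_Icc (a := a) (b := b)).prod (isCompact_unit_sphere_sum (κ := ι))) hZ using 1
  ext V
  constructor
  · rintro ⟨E, hE, φ, h, ht⟩
    exact ⟨(E, φ), ⟨hE, h.2⟩, h, ht⟩
  · rintro ⟨⟨E, φ⟩, ⟨hE, _⟩, h, ht⟩
    exact ⟨E, hE, φ, h, ht⟩

theorem isClosed_eigenpair_pair_set (K K' : Matrix ι ι ℝ) (a b a' b' t : ℝ) (n m : ι) :
    IsClosed {V : ι → ℝ | ∃ E ∈ Set.Icc a b, ∃ E' ∈ Set.Icc a' b', ∃ φ φ' : ι → ℝ,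
      IsEigenpair K V E φ ∧ IsEigenpair K' V E' φ' ∧
      t ≤ |φ n ^ 2 * φ' m ^ 2 - φ m ^ 2 * φ' n ^ 2|} := by
  have hZ : IsClosed {p : (ι → ℝ) × ((ℝ × ℝ) × ((ι → ℝ) × (ι → ℝ))) |
      IsEigenpair K p.1 p.2.1.1 p.2.2.1 ∧ IsEigenpair K' p.1 p.2.1.2 p.2.2.2 ∧
      t ≤ |p.2.2.1 n ^ 2 * p.2.2.2 m ^ 2 - p.2.2.1 m ^ 2 * p.2.2.2 n ^ 2|} :=
    (isClosed_isEigenpair K (V := fun p : (ι → ℝ) × ((ℝ × ℝ) × ((ι → ℝ) × (ι → ℝ))) => p.1)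
      (φ := fun p => p.2.2.1) (E := fun p => p.2.1.1)
      (by fun_prop) (by fun_prop) (by fun_prop)).inter
      ((isClosed_isEigenpair K' (V := fun p : (ι → ℝ) × ((ℝ × ℝ) × ((ι → ℝ) × (ι → ℝ))) => p.1)
      (φ := fun p => p.2.2.2) (E := fun p => p.2.1.2)
      (by fun_prop) (by fun_prop) (by fun_prop)).inter
      (isClosed_le (f := fun _ => t) (g := fun p : (ι → ℝ) × ((ℝ × ℝ) × ((ι → ℝ) × (ι → ℝ))) =>
        |p.2.2.1 n ^ 2 * p.2.2.2 m ^ 2 - p.2.2.1 m ^ 2 * p.2.2.2 n ^ 2|) continuous_const (by fun_prop)))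
  convert isClosed_exists_mem_compact
    (((isCompact_Icc (a := a) (b := b)).prod (isCompact_Icc (a := a') (b := b'))).prod
      ((isCompact_unit_sphere_sum (κ := ι)).prod (isCompact_unit_sphere_sum (κ := ι)))) hZ using 1
  ext V
  constructor
  · rintro ⟨E, hE, E', hE', φ, φ', h, h', ht⟩
    exact ⟨((E, E'), (φ, φ')), ⟨⟨hE, hE'⟩, h.2, h'.2⟩, h, h', ht⟩
  · rintro ⟨⟨⟨E, E'⟩, ⟨φ, φ'⟩⟩, ⟨⟨hE, hE'⟩, _⟩, h, h', ht⟩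
    exact ⟨E, hE, E', hE', φ, φ', h, h', ht⟩

/-- Membership in `B` does not depend on the coordinate `n`, so integrating that coordinate first
yields the factor `c` on top of the mass of `B`. Iterating this plays the role of independence for
successive constraints. -/
theorem pi_inter_le (ν : Measure ℝ) [IsProbabilityMeasure ν] {A B : Set (ι → ℝ)}
    (hA : MeasurableSet A) (hB : MeasurableSet B) (n : ι)
    (hinv : ∀ v x, Function.update v n x ∈ B → v ∈ B) {c : ℝ≥0∞}
    (hc : ∀ v, ν {x | Function.update v n x ∈ A} ≤ c) :
    Measure.pi (fun _ : ι => ν) (A ∩ B) ≤ c * Measure.pi (fun _ : ι => ν) B := by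
  have hAB := hA.inter hB
  rw [← lintegral_indicator_one hAB, ← lintegral_indicator_one hB,
    ← lintegral_const_mul c (measurable_one.indicator hB)]
  refine lintegral_le_of_lmarginal_le (μ := fun _ : ι => ν) {n} (measurable_one.indicator hAB)
    ((measurable_one.indicator hB).const_mul c) ?_
  intro v
  rw [lmarginal_singleton, lmarginal_singleton]
  have hm : MeasurableSet {x | Function.update v n x ∈ A} :=
    (measurable_update v) hA
  by_cases hv : v ∈ B
  · have hall : ∀ x, Function.update v n x ∈ B := by
      intro x
      refine hinv _ (v n) ?_
      simpa using hv
    calc ∫⁻ x, (A ∩ B).indicator 1 (Function.update v n x) ∂ν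
        ≤ ∫⁻ x, {x | Function.update v n x ∈ A}.indicator 1 x ∂ν := by
          refine lintegral_mono fun x => ?_
          by_cases hx : Function.update v n x ∈ A
          · simp [hx, hall x]
          · simp [hx]
      _ = ν {x | Function.update v n x ∈ A} := lintegral_indicator_one hm
      _ ≤ c := hc v
      _ = ∫⁻ x, c * B.indicator 1 (Function.update v n x) ∂ν := by simp [hall]
  · have hall : ∀ x, Function.update v n x ∉ B := fun x hx => hv (hinv v x hx)
    simp [hall]

theorem pi_le_of_slice (ν : Measure ℝ) [IsProbabilityMeasure ν] {A : Set (ι → ℝ)}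
    (hA : MeasurableSet A) (n : ι) {c : ℝ≥0∞} (hc : ∀ v, ν {x | Function.update v n x ∈ A} ≤ c) :
    Measure.pi (fun _ : ι => ν) A ≤ c := by
  simpa using pi_inter_le ν hA MeasurableSet.univ n (fun _ _ _ => Set.mem_univ _) hc

theorem pi_le_of_pair_slice (ν : Measure ℝ) [IsProbabilityMeasure ν] {k : ℝ≥0∞}
    (hν : ν ≤ k • volume) {A : Set (ι → ℝ)} (hA : MeasurableSet A) {n m : ι} (hnm : n ≠ m)
    {c : ℝ≥0∞} (hc : ∀ v, volume {x : ℝ × ℝ |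
      Function.update (Function.update v n x.1) m x.2 ∈ A} ≤ c) :
    Measure.pi (fun _ : ι => ν) A ≤ k * (k * c) := by
  have hone : (1 : ℝ≥0∞) * (k * (k * c)) = ∫⁻ _, k * (k * c) ∂(Measure.pi (fun _ : ι => ν)) := by
    simp
  rw [← one_mul (k * (k * c)), hone, ← lintegral_indicator_one hA]
  refine lintegral_le_of_lmarginal_le (μ := fun _ : ι => ν) {n, m} (measurable_one.indicator hA)
    measurable_const ?_
  intro v
  have hconst : (∫⋯∫⁻_{n, m}, (fun _ => k * (k * c)) ∂(fun _ : ι => ν)) v = k * (k * c) := by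
    rw [lmarginal_insert _ measurable_const (by simpa using hnm)]
    simp [lmarginal_singleton]
  rw [hconst, lmarginal_insert _ (measurable_one.indicator hA) (by simpa using hnm)]
  simp only [lmarginal_singleton]
  have hmeas2 : Measurable fun x : ℝ × ℝ => Function.update (Function.update v n x.1) m x.2 := by
    refine measurable_pi_iff.2 fun i => ?_
    by_cases him : i = m
    · subst him; simpa using measurable_snd
    · by_cases hin : i = n
      · subst hin; simpa [him] using measurable_fst
      · simp [him, hin]
  have hS : MeasurableSet {x : ℝ × ℝ | Function.update (Function.update v n x.1) m x.2 ∈ A} :=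
    hmeas2 hA
  have hle : ∀ g : ℝ → ℝ≥0∞, ∫⁻ x, g x ∂ν ≤ k * ∫⁻ x, g x := fun g =>
    (lintegral_mono' hν le_rfl).trans_eq (by rw [lintegral_smul_measure, smul_eq_mul])
  calc ∫⁻ x, ∫⁻ y, A.indicator 1 (Function.update (Function.update v n x) m y) ∂ν ∂ν
      ≤ ∫⁻ x, (k * ∫⁻ y, A.indicator 1 (Function.update (Function.update v n x) m y)) ∂ν :=
        lintegral_mono fun x => hle fun y => A.indicator 1 (Function.update (Function.update v n x) m y)
    _ ≤ k * ∫⁻ x, k * ∫⁻ y, A.indicator 1 (Function.update (Function.update v n x) m y) := hle _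
    _ = k * (k * ∫⁻ x, ∫⁻ y, A.indicator 1 (Function.update (Function.update v n x) m y)) := by
        rw [lintegral_const_mul]
        exact ((measurable_one.indicator hA).comp hmeas2).lintegral_prod_right'
    _ = k * (k * ∫⁻ p : ℝ × ℝ, A.indicator 1 (Function.update (Function.update v n p.1) m p.2)) := by
        rw [Measure.volume_eq_prod, lintegral_prod]
        exact ((measurable_one.indicator hA).comp hmeas2).aemeasurable
    _ ≤ k * (k * c) := by
        gcongr
        refine le_trans (le_of_eq ?_) (hc v)
        rw [← lintegral_indicator_one hS]
        rfl

/-- Two operators with the same random potential rarely both have an eigenvalue in given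
intervals with eigenvectors that react differently to the potential at two sites. -/
theorem pi_eigenpair_pair_le {K K' : Matrix ι ι ℝ} (hK : K.IsHermitian)
    (hK' : K'.IsHermitian) (hs : SimpleKernel K) (hs' : SimpleKernel K')
    (ν : Measure ℝ) [IsProbabilityMeasure ν] {k : ℝ≥0∞} (hν : ν ≤ k • volume)
    {n m : ι} (hnm : n ≠ m) (a b a' b' : ℝ) {τ : ℝ} (hτ : 0 < τ) :
    Measure.pi (fun _ : ι => ν) {V : ι → ℝ | ∃ E ∈ Set.Icc a b, ∃ E' ∈ Set.Icc a' b',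
      ∃ φ φ' : ι → ℝ, IsEigenpair K V E φ ∧ IsEigenpair K' V E' φ' ∧
      τ ≤ |φ n ^ 2 * φ' m ^ 2 - φ m ^ 2 * φ' n ^ 2|} ≤
    k * (k * (2 * (ENNReal.ofReal τ⁻¹ * (ENNReal.ofReal (b - a) * ENNReal.ofReal (b' - a'))))) := by
  refine pi_le_of_pair_slice ν hν
    (isClosed_eigenpair_pair_set K K' a b a' b' τ n m).measurableSet hnm fun v => ?_
  rw [← Real.volume_Icc, ← Real.volume_Icc]
  exact volume_eigenpair_pair_slice_le hK hK' hs hs' v hnm measurableSet_Icc measurableSet_Icc hτ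

/-! ### The Wegner estimate -/

theorem half_sub_le_sum_dyadic {p : ℝ} (hp1 : p ≤ 1) (Q : ℕ) :
    p / 2 - (1 / 2) ^ Q ≤ ∑ i ∈ Finset.range Q, if (1 / 2 : ℝ) ^ i ≤ p then (1 / 2 : ℝ) ^ i else 0 := by
  induction Q with
  | zero => simp; linarith
  | succ Q ih =>
    rw [Finset.sum_range_succ]
    have hpow : (0 : ℝ) < (1 / 2) ^ Q := by positivity
    have hnn : 0 ≤ ∑ i ∈ Finset.range Q, if (1 / 2 : ℝ) ^ i ≤ p then (1 / 2 : ℝ) ^ i else 0 :=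
      Finset.sum_nonneg fun i _ => by split_ifs <;> positivity
    split_ifs with h
    · rw [pow_succ]; linarith
    · rw [pow_succ]; push Not at h; linarith

/-- A Wegner estimate, up to a logarithm of the size. -/
theorem pi_eigenpair_le {K : Matrix ι ι ℝ} (hK : K.IsHermitian) (hs : SimpleKernel K)
    (ν : Measure ℝ) [IsProbabilityMeasure ν] {k : ℝ≥0∞} (hν : ν ≤ k • volume)
    (a b : ℝ) {Q : ℕ} (hQ : 4 * Fintype.card ι ≤ 2 ^ Q) :
    Measure.pi (fun _ : ι => ν) {V : ι → ℝ | ∃ E ∈ Set.Icc a b, ∃ φ, IsEigenpair K V E φ} ≤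
      4 * (Q * (Fintype.card ι * (k * ENNReal.ofReal (b - a)))) := by
  -- Averaging at `n` loses `2 ^ i` on the level `φ n ^ 2 ≥ 2 ^ (-i)`, which the weight `2 ^ (-i)`
  -- in `g` compensates. As `∑ φ n ^ 2 = 1`, the weighted count `g` is at least `1/4` whenever there
  -- is an eigenvalue, so Markov's inequality applies; the number `Q` of levels is the logarithmic
  -- loss.
  let A : ℕ → ι → Set (ι → ℝ) := fun i n =>
    {V | ∃ E ∈ Set.Icc a b, ∃ φ, IsEigenpair K V E φ ∧ (1 / 2 : ℝ) ^ i ≤ φ n ^ 2}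
  have hAm : ∀ i n, MeasurableSet (A i n) := fun i n =>
    (isClosed_eigenpair_set K a b _ n).measurableSet
  have hA : ∀ i n, ENNReal.ofReal ((1 / 2) ^ i) * Measure.pi (fun _ : ι => ν) (A i n) ≤
      k * ENNReal.ofReal (b - a) := by
    intro i n
    have hpos : (0 : ℝ) < (1 / 2) ^ i := by positivity
    have h1 : Measure.pi (fun _ : ι => ν) (A i n) ≤
        k * (ENNReal.ofReal ((1 / 2) ^ i)⁻¹ * ENNReal.ofReal (b - a)) := by
      refine pi_le_of_slice ν (hAm i n) n fun v => (hν _).trans ?_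
      rw [Measure.smul_apply, smul_eq_mul, ← Real.volume_Icc]
      gcongr
      exact volume_eigenpair_slice_le hK hs v n measurableSet_Icc hpos
    calc _ ≤ ENNReal.ofReal ((1 / 2) ^ i) *
          (k * (ENNReal.ofReal ((1 / 2) ^ i)⁻¹ * ENNReal.ofReal (b - a))) := by gcongr
      _ = (ENNReal.ofReal ((1 / 2) ^ i) * ENNReal.ofReal ((1 / 2) ^ i)⁻¹) *
          (k * ENNReal.ofReal (b - a)) := by ring
      _ = _ := by
        rw [← ENNReal.ofReal_mul hpos.le, mul_inv_cancel₀ hpos.ne', ENNReal.ofReal_one, one_mul]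
  let g : (ι → ℝ) → ℝ≥0∞ := fun V => ∑ i ∈ Finset.range Q, ∑ n,
    (A i n).indicator (fun _ => ENNReal.ofReal ((1 / 2) ^ i)) V
  have hg : ∫⁻ V, g V ∂(Measure.pi fun _ : ι => ν) ≤
      Q * (Fintype.card ι * (k * ENNReal.ofReal (b - a))) := by
    have hme : ∀ i n, Measurable ((A i n).indicator
        (fun _ => ENNReal.ofReal ((1 / 2) ^ i))) := fun i n =>
      measurable_const.indicator (hAm i n)
    simp only [g]
    rw [lintegral_finsetSum _ fun i _ => Finset.measurable_fun_sum _ fun n _ => hme i n]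
    calc _ ≤ ∑ i ∈ Finset.range Q, (Fintype.card ι * (k * ENNReal.ofReal (b - a))) := by
          refine Finset.sum_le_sum fun i _ => ?_
          rw [lintegral_finsetSum _ fun n _ => hme i n]
          calc _ ≤ ∑ n : ι, k * ENNReal.ofReal (b - a) := by
                refine Finset.sum_le_sum fun n _ => ?_
                rw [lintegral_indicator_const (hAm i n)]
                exact hA i n
            _ = _ := by simp
      _ = _ := by simp
  have hsub : {V : ι → ℝ | ∃ E ∈ Set.Icc a b, ∃ φ, IsEigenpair K V E φ} ⊆
      {V | (4 : ℝ≥0∞)⁻¹ ≤ g V} := by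
    rintro V ⟨E, hE, φ, hφ⟩
    have hle1 : ∀ n, φ n ^ 2 ≤ 1 := fun n => by
      rw [← hφ.2]
      exact Finset.single_le_sum (f := fun j => φ j ^ 2) (fun j _ => sq_nonneg _)
        (Finset.mem_univ n)
    have hreal : (1 / 4 : ℝ) ≤ ∑ n, ∑ i ∈ Finset.range Q,
        if (1 / 2 : ℝ) ^ i ≤ φ n ^ 2 then (1 / 2 : ℝ) ^ i else 0 := by
      have h1 : ∑ n, (φ n ^ 2 / 2 - (1 / 2) ^ Q) ≤ ∑ n, ∑ i ∈ Finset.range Q,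
          if (1 / 2 : ℝ) ^ i ≤ φ n ^ 2 then (1 / 2 : ℝ) ^ i else 0 :=
        Finset.sum_le_sum fun n _ => half_sub_le_sum_dyadic (hle1 n) Q
      have h2 : ∑ n, (φ n ^ 2 / 2 - (1 / 2 : ℝ) ^ Q) =
          1 / 2 - (Fintype.card ι : ℝ) * (1 / 2 : ℝ) ^ Q := by
        rw [Finset.sum_sub_distrib, ← Finset.sum_div, hφ.2]; simp
      have h3 : (Fintype.card ι : ℝ) * (1 / 2) ^ Q ≤ 1 / 4 := by
        have : (4 * Fintype.card ι : ℝ) ≤ 2 ^ Q := by exact_mod_cast hQ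
        rw [one_div, inv_pow, ← div_eq_mul_inv, div_le_iff₀ (by positivity)]
        linarith
      linarith
    rw [Finset.sum_comm] at hreal
    have : (4 : ℝ≥0∞)⁻¹ = ENNReal.ofReal (1 / 4) := by
      rw [one_div, ENNReal.ofReal_inv_of_pos (by norm_num)]; simp
    rw [Set.mem_ofPred_eq, this]
    refine (ENNReal.ofReal_le_ofReal hreal).trans ?_
    have hnn : ∀ (i : ℕ) (n : ι), 0 ≤ if (1 / 2 : ℝ) ^ i ≤ φ n ^ 2 then (1 / 2 : ℝ) ^ i else 0 :=
      fun i n => by split_ifs <;> positivity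
    rw [ENNReal.ofReal_sum_of_nonneg fun i _ => Finset.sum_nonneg fun n _ => hnn i n]
    refine Finset.sum_le_sum fun i _ => ?_
    rw [ENNReal.ofReal_sum_of_nonneg fun n _ => hnn i n]
    refine Finset.sum_le_sum fun n _ => ?_
    split_ifs with h
    · have hm : V ∈ A i n := ⟨E, hE, φ, hφ, h⟩
      simp [hm]
    · simp
  have hmarkov := mul_meas_ge_le_lintegral (μ := Measure.pi fun _ : ι => ν) (f := g)
    (Finset.measurable_fun_sum _ fun i _ => Finset.measurable_fun_sum _ fun n _ =>
      measurable_const.indicator (hAm i n)) (4 : ℝ≥0∞)⁻¹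
  calc _ ≤ Measure.pi (fun _ : ι => ν) {V | (4 : ℝ≥0∞)⁻¹ ≤ g V} := measure_mono hsub
    _ = 4 * ((4 : ℝ≥0∞)⁻¹ * Measure.pi (fun _ : ι => ν) {V | (4 : ℝ≥0∞)⁻¹ ≤ g V}) := by
      rw [← mul_assoc, ENNReal.mul_inv_cancel (by norm_num) (by norm_num), one_mul]
    _ ≤ _ := mul_le_mul' le_rfl (hmarkov.trans hg)

/-! ### Chains: the deterministic part -/

theorem abs_div_le_mul_abs {H a z : ℝ} (ha : 1 ≤ H * |a|) : |z / a| ≤ H * |z| := by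
  have ha0 : 0 < |a| := by
    rcases (abs_nonneg a).eq_or_lt with h | h
    · rw [← h, mul_zero] at ha; linarith
    · exact h
  rw [abs_div, div_le_iff₀ ha0]
  nlinarith [abs_nonneg z]

theorem abs_div_mul_le {H a a' z : ℝ} (hH : 0 ≤ H) (ha : 1 ≤ H * |a|) (ha' : 1 ≤ H * |a'|) :
    |z / (a * a')| ≤ H ^ 2 * |z| := by
  rw [← div_div]
  calc |z / a / a'| ≤ H * |z / a| := abs_div_le_mul_abs ha'
    _ ≤ H * (H * |z|) := by gcongr; exact abs_div_le_mul_abs ha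
    _ = _ := by ring

/-- The part of the next value of a chain that does not involve the potential at the site. -/
def chainDrift (c : ℝ) (b t : ℕ → ℝ) (i : ℕ) (p : ℝ × ℝ) : ℝ :=
  (c * p.2 - t i * b i * p.1) / (t (i + 1) * b (i + 1))

/-- The next value of a chain, computed without the potential where this is possible. -/
def chainNext (c μ lam : ℝ) (b t : ℕ → ℝ) (i : ℕ) (p : ℝ × ℝ) (x : ℝ) : ℝ :=
  if t (i + 1) = 0 then ((x - μ) * p.2 - lam * b i * p.1) / (lam * b (i + 1))
  else chainDrift c b t i p

/-- The pairs of consecutive values of a chain with initial values `1, r`. -/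
def chainState (c μ lam : ℝ) (b t W : ℕ → ℝ) (r : ℝ) : ℕ → ℝ × ℝ
  | 0 => (1, r)
  | i + 1 => ((chainState c μ lam b t W r i).2,
      chainNext c μ lam b t i (chainState c μ lam b t W r i) (W (i + 1)))

/-- The quantity that has to be small for a chain to continue at the site `i + 1`. -/
def chainResidual (c μ lam : ℝ) (b t : ℕ → ℝ) (i : ℕ) (p : ℝ × ℝ) (x : ℝ) : ℝ :=
  (x - μ) * p.2 - lam * b i * p.1 -
    if t (i + 1) = 0 then 0 else lam * b (i + 1) * chainDrift c b t i p

/-- A chain of length `N`: an approximate solution of two difference equations, one of which does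
not involve the potential. -/
structure IsChain (H c μ lam : ℝ) (N : ℕ) (b t W f : ℕ → ℝ) (x : ℝ) : Prop where
  one_le : 1 ≤ H
  hop : ∀ i ≤ N, |b i| ≤ H ∧ 1 ≤ H * |b i|
  coupling : |lam| ≤ H ∧ 1 ≤ H * |lam|
  gap : |c| ≤ H ∧ (c ≠ 0 → 1 ≤ H * |c|)
  link : ∀ i ≤ N, |t i| ≤ H ∧ (t i ≠ 0 → 1 ≤ H * |t i|) ∧ (t i = 0 → c ≠ 0)
  pot : ∀ i < N, |W (i + 1) - μ| ≤ H
  start : f 0 = 1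
  eq : ∀ i < N, |(W (i + 1) - μ) * f (i + 1) - lam * (b (i + 1) * f (i + 2) + b i * f i)| ≤ x
  free : ∀ i < N, |t (i + 1) * b (i + 1) * f (i + 2) + t i * b i * f i - c * f (i + 1)| ≤ x
  pos : 0 < x

namespace IsChain

variable {H c μ lam : ℝ} {N : ℕ} {b t W f : ℕ → ℝ} {x : ℝ}

/-- Either equation is solved for `f (i + 2)` by dividing by two coefficients with inverses at most
`H`; the numerator is off by at most `H * D + H ^ 2 * D + x`. -/
theorem abs_chainNext_sub_le (h : IsChain H c μ lam N b t W f x) {i : ℕ} (hi : i < N) {p : ℝ × ℝ}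
    {D : ℝ} (h1 : |p.1 - f i| ≤ D) (h2 : |p.2 - f (i + 1)| ≤ D) (hD : x ≤ D) :
    |chainNext c μ lam b t i p (W (i + 1)) - f (i + 2)| ≤ 3 * H ^ 4 * D := by
  have hH := h.one_le
  have hD0 : 0 ≤ D := h.pos.le.trans hD
  have hb := h.hop i hi.le
  have hb' := h.hop (i + 1) hi
  have ht := h.link i hi.le
  have ht' := h.link (i + 1) hi
  have hfin : H ^ 2 * (H * D + H ^ 2 * D + x) ≤ 3 * H ^ 4 * D := by
    have h3 : H * D ≤ H ^ 2 * D := by gcongr; nlinarith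
    have h4 : x ≤ H ^ 2 * D := hD.trans (le_mul_of_one_le_left hD0 (one_le_pow₀ hH))
    calc _ ≤ H ^ 2 * (H ^ 2 * D + H ^ 2 * D + H ^ 2 * D) := by gcongr
      _ = _ := by ring
  unfold chainNext
  split_ifs with h0
  · have hne : lam * b (i + 1) ≠ 0 := by
      refine mul_ne_zero ?_ ?_ <;> intro hz
      · have := h.coupling.2; rw [hz] at this; norm_num at this
      · have := hb'.2; rw [hz] at this; norm_num at this
    have e : ((W (i + 1) - μ) * p.2 - lam * b i * p.1) / (lam * b (i + 1)) - f (i + 2) =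
        ((W (i + 1) - μ) * (p.2 - f (i + 1)) - lam * b i * (p.1 - f i) +
        ((W (i + 1) - μ) * f (i + 1) - lam * (b (i + 1) * f (i + 2) + b i * f i))) /
          (lam * b (i + 1)) := by
      rw [eq_div_iff hne, sub_mul, div_mul_cancel₀ _ hne]; ring
    rw [e]
    refine (abs_div_mul_le (by linarith) h.coupling.2 hb'.2).trans (le_trans ?_ hfin)
    gcongr
    refine (abs_add_le _ _).trans (add_le_add ((abs_sub _ _).trans (add_le_add ?_ ?_)) (h.eq i hi))
    · rw [abs_mul]; gcongr; exact h.pot i hi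
    · rw [abs_mul, abs_mul, pow_two]; gcongr; exacts [h.coupling.1, hb.1]
  · have hne : t (i + 1) * b (i + 1) ≠ 0 := by
      refine mul_ne_zero h0 ?_
      intro hz
      have := hb'.2; rw [hz] at this; norm_num at this
    have e : chainDrift c b t i p - f (i + 2) =
        (c * (p.2 - f (i + 1)) - t i * b i * (p.1 - f i) -
        (t (i + 1) * b (i + 1) * f (i + 2) + t i * b i * f i - c * f (i + 1))) /
          (t (i + 1) * b (i + 1)) := by
      unfold chainDrift; rw [eq_div_iff hne, sub_mul, div_mul_cancel₀ _ hne]; ring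
    rw [e]
    refine (abs_div_mul_le (by linarith) (ht'.2.1 h0) hb'.2).trans (le_trans ?_ hfin)
    gcongr
    refine (abs_sub _ _).trans (add_le_add ((abs_sub _ _).trans (add_le_add ?_ ?_)) (h.free i hi))
    · rw [abs_mul]; gcongr; exact h.gap.1
    · rw [abs_mul, abs_mul, pow_two]; gcongr; exacts [ht.1, hb.1]

theorem abs_chainState_sub_le (h : IsChain H c μ lam N b t W f x) {r : ℝ} (hr : |r - f 1| ≤ x)
    {i : ℕ} (hi : i ≤ N) :
    |(chainState c μ lam b t W r i).1 - f i| ≤ (3 * H ^ 4) ^ i * x ∧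
      |(chainState c μ lam b t W r i).2 - f (i + 1)| ≤ (3 * H ^ 4) ^ i * x := by
  have hA : 1 ≤ 3 * H ^ 4 := by linarith [one_le_pow₀ h.one_le (n := 4)]
  induction i with
  | zero => simpa [chainState, h.start] using ⟨h.pos.le, hr⟩
  | succ i ih =>
    obtain ⟨h1, h2⟩ := ih (by omega)
    have hD : x ≤ (3 * H ^ 4) ^ i * x := le_mul_of_one_le_left h.pos.le (one_le_pow₀ hA)
    refine ⟨h2.trans ?_, ?_⟩
    · have := h.pos; gcongr; omega
    · refine (h.abs_chainNext_sub_le (by omega) h1 h2 hD).trans_eq ?_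
      ring

/-- The eigenvalue equation run backwards: `|f i|` is at most `3 * H ^ 4` times the largest of `|f
(i + 1)|`, `|f (i + 2)|` and `x`. Since `f 0 = 1`, two consecutive values cannot decay faster than
geometrically, as long as the error `x` stays below that scale. -/
theorem inv_pow_le_max (h : IsChain H c μ lam N b t W f x) (hx : x * (3 * H ^ 4) ^ N < 1) {i : ℕ}
    (hi : i ≤ N) : 1 ≤ (3 * H ^ 4) ^ i * max |f i| |f (i + 1)| := by
  have hH := h.one_le
  have hA : 1 ≤ 3 * H ^ 4 := by linarith [one_le_pow₀ h.one_le (n := 4)]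
  induction i with
  | zero => simp [h.start]
  | succ i ih =>
    have ih := ih (by omega)
    have hiN : i < N := by omega
    set m := max |f (i + 1)| |f (i + 1 + 1)| with hm
    have hb := h.hop i hiN.le
    have hb' := h.hop (i + 1) hiN
    by_contra hlt
    push Not at hlt
    have hAi : 0 < (3 * H ^ 4) ^ (i + 1) := by positivity
    have hxi : (3 * H ^ 4) ^ (i + 1) * x < 1 := by
      refine lt_of_le_of_lt ?_ hx
      rw [mul_comm]
      have := h.pos
      gcongr
    have hmax : (3 * H ^ 4) ^ (i + 1) * max m x < 1 := by
      rw [mul_max_of_nonneg _ _ hAi.le]; exact max_lt hlt hxi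
    have hm0 : 0 ≤ m := le_max_of_le_left (abs_nonneg _)
    set m' := max m x with hm'
    have h1 : |f (i + 1)| ≤ m' := (le_max_left _ _).trans (le_max_left _ _)
    have h2 : |f (i + 2)| ≤ m' := (le_max_right _ _).trans (le_max_left _ _)
    have h3 : x ≤ m' := le_max_right _ _
    have hm'0 : 0 ≤ m' := hm0.trans (le_max_left _ _)
    have hne : lam * b i ≠ 0 := by
      refine mul_ne_zero ?_ ?_ <;> intro hz
      · have := h.coupling.2; rw [hz] at this; norm_num at this
      · have := hb.2; rw [hz] at this; norm_num at this
    have e : f i = ((W (i + 1) - μ) * f (i + 1) - lam * b (i + 1) * f (i + 2) -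
        ((W (i + 1) - μ) * f (i + 1) - lam * (b (i + 1) * f (i + 2) + b i * f i))) /
          (lam * b i) := by
      rw [eq_div_iff hne]; ring
    have hfi : |f i| ≤ 3 * H ^ 4 * m' := by
      rw [e]
      refine (abs_div_mul_le (by linarith) h.coupling.2 hb.2).trans ?_
      have h4 : |(W (i + 1) - μ) * f (i + 1) - lam * b (i + 1) * f (i + 2) -
        ((W (i + 1) - μ) * f (i + 1) - lam * (b (i + 1) * f (i + 2) + b i * f i))| ≤
          H * m' + H ^ 2 * m' + m' := by
        refine (abs_sub _ _).trans (add_le_add ((abs_sub _ _).trans (add_le_add ?_ ?_))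
          ((h.eq i hiN).trans h3))
        · rw [abs_mul]; gcongr; exact h.pot i hiN
        · rw [abs_mul, abs_mul, pow_two]; gcongr; exacts [h.coupling.1, hb'.1]
      have h5 : H * m' ≤ H ^ 2 * m' := by gcongr; nlinarith
      have h6 : m' ≤ H ^ 2 * m' := le_mul_of_one_le_left hm'0 (one_le_pow₀ hH)
      calc _ ≤ H ^ 2 * (H ^ 2 * m' + H ^ 2 * m' + H ^ 2 * m') := by gcongr; linarith
        _ = _ := by ring
    have hmi : max |f i| |f (i + 1)| ≤ 3 * H ^ 4 * m' :=
      max_le hfi (h1.trans (le_mul_of_one_le_left hm'0 hA))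
    have : (3 * H ^ 4) ^ i * max |f i| |f (i + 1)| ≤ (3 * H ^ 4) ^ (i + 1) * m' := by
      rw [pow_succ (3 * H ^ 4) i, mul_assoc]; gcongr
    linarith

/-- A lower bound on some values of a chain gives a constraint on the potential. -/
theorem abs_chainResidual_le (h : IsChain H c μ lam N b t W f x) {r : ℝ} (hr : |r - f 1| ≤ x)
    {i : ℕ} (hi : i < N) (hcase : t (i + 1) ≠ 0 ∨ |f (i + 2)| ≤ H * x) :
    |chainResidual c μ lam b t i (chainState c μ lam b t W r i) (W (i + 1))| ≤
      4 * (3 * H ^ 4) ^ (N + 1) * x := by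
  have hH := h.one_le
  have hA : 1 ≤ 3 * H ^ 4 := by linarith [one_le_pow₀ h.one_le (n := 4)]
  have hx := h.pos
  have hb := h.hop i hi.le
  have hb' := h.hop (i + 1) hi
  obtain ⟨h1, h2⟩ := h.abs_chainState_sub_le hr hi.le
  obtain ⟨-, h3⟩ := h.abs_chainState_sub_le hr hi
  set p := chainState c μ lam b t W r i with hp
  set D := (3 * H ^ 4) ^ N * x with hD
  have hD0 : 0 < D := by positivity
  have hDi : ∀ j ≤ N, (3 * H ^ 4) ^ j * x ≤ D := fun j hj => by
    rw [hD]; gcongr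
  have h1' := h1.trans (hDi i hi.le)
  have h2' := h2.trans (hDi i hi.le)
  have h3' := h3.trans (hDi (i + 1) hi)
  have hxD : x ≤ D := le_mul_of_one_le_left hx.le (one_le_pow₀ hA)
  have hmain : ∀ z : ℝ, |z - lam * b (i + 1) * f (i + 2)| ≤ H ^ 3 * D →
      |(W (i + 1) - μ) * p.2 - lam * b i * p.1 - z| ≤ 4 * (3 * H ^ 4) ^ (N + 1) * x := by
    intro z hz
    have e : (W (i + 1) - μ) * p.2 - lam * b i * p.1 - z =
        (W (i + 1) - μ) * (p.2 - f (i + 1)) - lam * b i * (p.1 - f i) +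
        ((W (i + 1) - μ) * f (i + 1) - lam * (b (i + 1) * f (i + 2) + b i * f i)) -
        (z - lam * b (i + 1) * f (i + 2)) := by ring
    have h4 : |(W (i + 1) - μ) * p.2 - lam * b i * p.1 - z| ≤
        H * D + H ^ 2 * D + D + H ^ 3 * D := by
      rw [e]
      refine (abs_sub _ _).trans (add_le_add ((abs_add_le _ _).trans (add_le_add
        ((abs_sub _ _).trans (add_le_add ?_ ?_)) ((h.eq i hi).trans hxD))) hz)
      · rw [abs_mul]; gcongr; exact h.pot i hi
      · rw [abs_mul, abs_mul, pow_two]; gcongr; exacts [h.coupling.1, hb.1]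
    have p1 : H * D ≤ H ^ 4 * D := by
      gcongr; exact le_self_pow₀ hH (by norm_num)
    have p2 : H ^ 2 * D ≤ H ^ 4 * D := by gcongr; norm_num
    have p3 : H ^ 3 * D ≤ H ^ 4 * D := by gcongr; norm_num
    have p4 : D ≤ H ^ 4 * D := le_mul_of_one_le_left hD0.le (one_le_pow₀ hH)
    have p5 : 4 * (3 * H ^ 4) ^ (N + 1) * x = 12 * (H ^ 4 * D) := by rw [hD]; ring
    have p6 : 0 ≤ H ^ 4 * D := by positivity
    linarith
  unfold chainResidual
  split_ifs with h0
  · refine hmain 0 ?_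
    rcases hcase with hc | hc
    · exact absurd h0 hc
    rw [zero_sub, abs_neg, abs_mul, abs_mul]
    calc |lam| * |b (i + 1)| * |f (i + 2)| ≤ H * H * (H * x) := by
          gcongr; exacts [h.coupling.1, hb'.1]
      _ = H ^ 3 * x := by ring
      _ ≤ _ := by gcongr
  · refine hmain _ ?_
    have hst : (chainState c μ lam b t W r (i + 1)).2 = chainDrift c b t i p := by
      simp [chainState, chainNext, h0, hp]
    rw [hst] at h3'
    rw [← mul_sub, abs_mul, abs_mul]
    calc |lam| * |b (i + 1)| * |chainDrift c b t i p - f (i + 2)| ≤ H * H * D := by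
          gcongr; exacts [h.coupling.1, hb'.1]
      _ = H ^ 2 * D := by ring
      _ ≤ _ := by gcongr; norm_num

/-- Among three consecutive sites of a chain, there is one at which the potential is constrained. -/
theorem exists_constraint (h : IsChain H c μ lam N b t W f x) {r : ℝ} (hr : |r - f 1| ≤ x)
    (hx : x * (4 * (3 * H ^ 4) ^ (2 * N + 2)) ≤ 1) {i : ℕ} (hi : i + 3 ≤ N) :
    ∃ j, i ≤ j ∧ j < i + 3 ∧
      1 ≤ 4 * (3 * H ^ 4) ^ (N + 1) * |(chainState c μ lam b t W r j).2| ∧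
      |chainResidual c μ lam b t j (chainState c μ lam b t W r j) (W (j + 1))| ≤
        4 * (3 * H ^ 4) ^ (N + 1) * x := by
  have hH := h.one_le
  set A := 3 * H ^ 4 with hA_def
  have hA : 1 ≤ A := by rw [hA_def]; linarith [one_le_pow₀ h.one_le (n := 4)]
  have hA3 : 3 ≤ A := by rw [hA_def]; linarith [one_le_pow₀ h.one_le (n := 4)]
  have hx0 := h.pos
  have hAN : 0 < A ^ N := by positivity
  have hAN1 : 1 ≤ A ^ N := one_le_pow₀ hA
  have hxx : x * (4 * A ^ 2 * A ^ N * A ^ N) ≤ 1 := by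
    calc _ = x * (4 * A ^ (2 * N + 2)) := by ring
      _ ≤ 1 := hx
  have hxlt : x * A ^ N < 1 := by
    refine lt_of_lt_of_le ?_ hxx
    have : A ^ N < 4 * A ^ 2 * A ^ N * A ^ N := by
      have q : 1 < 4 * A ^ 2 * A ^ N := by nlinarith [mul_le_mul hA hAN1 zero_le_one (by linarith)]
      exact lt_mul_of_one_lt_left hAN q
    gcongr
  have hmax : ∀ j ≤ N, 1 ≤ A ^ N * max |f j| |f (j + 1)| := fun j hj =>
    (h.inv_pow_le_max hxlt hj).trans (by gcongr)
  -- a value of size at least `(2 A ^ (N + 1))⁻¹` is well approximated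
  have happ : ∀ j < N, 1 ≤ 2 * A ^ (N + 1) * |f (j + 1)| →
      1 ≤ 4 * A ^ (N + 1) * |(chainState c μ lam b t W r j).2| := by
    intro j hj hf
    obtain ⟨-, h2⟩ := h.abs_chainState_sub_le hr hj.le
    have h3 : |f (j + 1)| ≤ |(chainState c μ lam b t W r j).2| + A ^ N * x := by
      have h4 : A ^ j * x ≤ A ^ N * x := by gcongr
      have h5 := abs_sub_abs_le_abs_sub (f (j + 1)) (chainState c μ lam b t W r j).2
      rw [abs_sub_comm] at h5
      linarith
    have h6 : 4 * A ^ (N + 1) * (A ^ N * x) ≤ 1 := by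
      refine le_trans ?_ hxx
      have : A ≤ A ^ 2 := by nlinarith
      calc _ = x * (4 * A * A ^ N * A ^ N) := by ring
        _ ≤ _ := by gcongr
    have hpos : 0 < A ^ (N + 1) := by positivity
    nlinarith
  have hcons : ∀ j < N, (t (j + 1) ≠ 0 ∨ |f (j + 2)| ≤ H * x) → 1 ≤ 2 * A ^ (N + 1) * |f (j + 1)| →
      1 ≤ 4 * A ^ (N + 1) * |(chainState c μ lam b t W r j).2| ∧
      |chainResidual c μ lam b t j (chainState c μ lam b t W r j) (W (j + 1))| ≤
        4 * A ^ (N + 1) * x :=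
    fun j hj hc hf => ⟨happ j hj hf, h.abs_chainResidual_le hr hj hc⟩
  have hbig : ∀ z : ℝ, 1 ≤ A ^ N * |z| → 1 ≤ 2 * A ^ (N + 1) * |z| := fun z hz => by
    rw [pow_succ]
    have : 0 ≤ A ^ N * |z| := by positivity
    nlinarith
  -- If `t (j + 1) ≠ 0`, the free equation predicts `f (j + 2)` and so the potential at `j + 1`. If
  -- `t (j + 1) = 0 = t (j + 2)`, then `c ≠ 0` makes `f (j + 2)` negligible and the potential at `j
  -- + 1` is again determined. If only `t (j + 1)` vanishes, a small `f (j + 2)` would make `f (j +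
  -- 3)` small as well; so `f (j + 2)` is large and the constraint sits at `j + 2`.
  have hstep : ∀ j, j + 2 ≤ N → 1 ≤ 2 * A ^ (N + 1) * |f (j + 1)| → ∃ j', j ≤ j' ∧ j' < j + 2 ∧
      1 ≤ 4 * A ^ (N + 1) * |(chainState c μ lam b t W r j').2| ∧
      |chainResidual c μ lam b t j' (chainState c μ lam b t W r j') (W (j' + 1))| ≤
        4 * A ^ (N + 1) * x := by
    intro j hj hf
    by_cases h0 : t (j + 1) = 0
    · have hfree := h.free (j + 1) (by omega)
      rw [h0] at hfree
      have hcne := (h.link (j + 1) (by omega)).2.2 h0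
      by_cases h1 : t (j + 2) = 0
      · refine ⟨j, le_rfl, by omega, hcons j (by omega) (Or.inr ?_) hf⟩
        have h2 : |c * f (j + 2)| ≤ x := by
          have : t (j + 1 + 1) = 0 := h1
          rw [this] at hfree
          simpa using hfree
        rw [abs_mul] at h2
        have h3 := h.gap.2 hcne
        calc |f (j + 2)| ≤ H * |c| * |f (j + 2)| := le_mul_of_one_le_left (abs_nonneg _) h3
          _ = H * (|c| * |f (j + 2)|) := by ring
          _ ≤ H * x := by gcongr
      · refine ⟨j + 1, by omega, by omega, hcons (j + 1) (by omega) (Or.inl h1) ?_⟩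
        rcases le_max_iff.1 (le_of_eq (rfl : max |f (j + 2)| |f (j + 3)| = _)) with hm | hm
        · exact hbig _ ((hmax (j + 2) hj).trans (by gcongr))
        · have h4 : 1 ≤ A ^ N * |f (j + 3)| := (hmax (j + 2) hj).trans (by gcongr)
          have h5 : |t (j + 2) * b (j + 2) * f (j + 3)| ≤ H * |f (j + 2)| + x := by
            have e : t (j + 2) * b (j + 2) * f (j + 3) =
                (t (j + 1 + 1) * b (j + 1 + 1) * f (j + 1 + 2) + 0 * b (j + 1) * f (j + 1) -
                c * f (j + 1 + 1)) + c * f (j + 2) := by ring_nf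
            rw [e]
            refine (abs_add_le _ _).trans ?_
            rw [add_comm]
            refine add_le_add ?_ hfree
            rw [abs_mul]; gcongr; exact h.gap.1
          have hb2 := (h.hop (j + 2) hj).2
          have ht2 := (h.link (j + 2) hj).2.1 h1
          have h6 : |f (j + 3)| ≤ H ^ 2 * (H * |f (j + 2)| + x) := by
            rw [abs_mul, abs_mul] at h5
            calc |f (j + 3)| = 1 * 1 * |f (j + 3)| := by ring
              _ ≤ (H * |t (j + 2)|) * (H * |b (j + 2)|) * |f (j + 3)| := by gcongr
              _ = H ^ 2 * (|t (j + 2)| * |b (j + 2)| * |f (j + 3)|) := by ring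
              _ ≤ _ := by gcongr
          have h7 : 1 ≤ A ^ N * (H ^ 3 * |f (j + 2)| + H ^ 2 * x) := by
            refine h4.trans ?_
            gcongr
            linarith
          have h8 : H ^ 3 ≤ A := by
            have : H ^ 3 ≤ H ^ 4 := pow_le_pow_right₀ hH (by norm_num)
            have : 0 ≤ H ^ 4 := by positivity
            rw [hA_def]; linarith
          have h9 : H ^ 2 ≤ A := by
            have : H ^ 2 ≤ H ^ 4 := pow_le_pow_right₀ hH (by norm_num)
            have : 0 ≤ H ^ 4 := by positivity
            rw [hA_def]; linarith
          have h10 : A ^ N * (H ^ 2 * x) ≤ 1 / 4 := by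
            have e1 : A ^ N * (H ^ 2 * x) ≤ A ^ N * (A * x) := by gcongr
            have e2 : 4 * (A ^ N * (A * x)) ≤ x * (4 * A ^ 2 * A ^ N * A ^ N) := by
              have : A * A ^ N ≤ A ^ 2 * A ^ N * A ^ N := by
                have q1 : A ≤ A ^ 2 := by nlinarith
                calc A * A ^ N ≤ A ^ 2 * A ^ N := by gcongr
                  _ ≤ A ^ 2 * A ^ N * A ^ N := le_mul_of_one_le_right (by positivity) hAN1
              nlinarith
            linarith
          have h11 : A ^ N * (H ^ 3 * |f (j + 2)|) ≤ A ^ (N + 1) * |f (j + 2)| := by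
            rw [pow_succ A N, mul_assoc]
            exact mul_le_mul_of_nonneg_left (mul_le_mul_of_nonneg_right h8 (abs_nonneg _)) hAN.le
          have : A ^ N * (H ^ 3 * |f (j + 2)| + H ^ 2 * x) =
            A ^ N * (H ^ 3 * |f (j + 2)|) + A ^ N * (H ^ 2 * x) := by ring
          have h12 : |f (j + 1 + 1)| = |f (j + 2)| := rfl
          rw [h12]
          linarith
    · exact ⟨j, le_rfl, by omega, hcons j (by omega) (Or.inl h0) hf⟩
  -- One of two consecutive values is large, and from there at most two candidates are needed: three
  -- in total.
  rcases le_max_iff.1 (le_of_eq (rfl : max |f (i + 1)| |f (i + 2)| = _)) with hm | hm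
  · obtain ⟨j, h1, h2, h3⟩ := hstep i (by omega)
      (hbig _ ((hmax (i + 1) (by omega)).trans (by gcongr)))
    exact ⟨j, h1, by omega, h3⟩
  · obtain ⟨j, h1, h2, h3⟩ := hstep (i + 1) (by omega)
      (hbig _ ((hmax (i + 1) (by omega)).trans (by gcongr)))
    exact ⟨j, by omega, by omega, h3⟩

end IsChain

/-! ### Chains are improbable -/

theorem chainState_congr {c μ lam : ℝ} {b t W W' : ℕ → ℝ} {r : ℝ} {j : ℕ}
    (h : ∀ i, 1 ≤ i → i ≤ j → W i = W' i) :
    chainState c μ lam b t W r j = chainState c μ lam b t W' r j := by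
  induction j with
  | zero => rfl
  | succ j ih =>
    simp only [chainState]
    rw [ih fun i h1 h2 => h i h1 (by omega), h (j + 1) (by omega) le_rfl]

theorem measurable_chainState {κ : Type*} (c μ lam : ℝ) (b t : ℕ → ℝ) (site : ℕ → κ) (r : ℝ)
    (j : ℕ) : Measurable fun v : κ → ℝ => chainState c μ lam b t (fun i => v (site i)) r j := by
  induction j with
  | zero => exact measurable_const
  | succ j ih =>
    simp only [chainState, chainNext, chainDrift]
    refine ih.snd.prodMk ?_
    split_ifs
    · have h1 := ih.fst; have h2 := ih.snd
      fun_prop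
    · have h1 := ih.fst; have h2 := ih.snd
      fun_prop

/-- The potentials that are constrained by the chain at the site `j + 1`. -/
def constraintSet {κ : Type*} (c μ lam : ℝ) (b t : ℕ → ℝ) (site : ℕ → κ) (r B x : ℝ) (j : ℕ) :
    Set (κ → ℝ) :=
  {v | 1 ≤ B * |(chainState c μ lam b t (fun i => v (site i)) r j).2| ∧
    |chainResidual c μ lam b t j (chainState c μ lam b t (fun i => v (site i)) r j)
      (v (site (j + 1)))| ≤ B * x}

theorem measurableSet_constraintSet {κ : Type*} (c μ lam : ℝ) (b t : ℕ → ℝ) (site : ℕ → κ)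
    (r B x : ℝ) (j : ℕ) : MeasurableSet (constraintSet c μ lam b t site r B x j) := by
  have h := measurable_chainState c μ lam b t site r j
  have h1 := h.fst
  have h2 := h.snd
  have e : constraintSet c μ lam b t site r B x j =
      (fun v : κ → ℝ => B * |(chainState c μ lam b t (fun i => v (site i)) r j).2|) ⁻¹' Set.Ici 1 ∩
      (fun v : κ → ℝ => |chainResidual c μ lam b t j
        (chainState c μ lam b t (fun i => v (site i)) r j) (v (site (j + 1)))|) ⁻¹'
          Set.Iic (B * x) := rfl
  rw [e]
  refine MeasurableSet.inter (measurableSet_Ici.preimage ?_) (measurableSet_Iic.preimage ?_)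
  · fun_prop
  · unfold chainResidual chainDrift
    split_ifs <;> fun_prop

theorem volume_abs_mul_sub_le {q s ρ B : ℝ} (hq : 1 ≤ B * |q|) (hρ : 0 ≤ ρ) :
    volume {y : ℝ | |y * q - s| ≤ ρ} ≤ ENNReal.ofReal (2 * (B * ρ)) := by
  have hq0 : 0 < |q| := by
    rcases (abs_nonneg q).eq_or_lt with h | h
    · rw [← h, mul_zero] at hq; linarith
    · exact h
  rw [← Real.volume_closedBall (s / q) (B * ρ)]
  refine measure_mono fun y hy => ?_
  rw [Metric.mem_closedBall, Real.dist_eq]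
  have e : y - s / q = (y * q - s) / q := by
    rw [sub_div, mul_div_cancel_right₀ _ (abs_pos.1 hq0)]
  rw [e, abs_div, div_le_iff₀ hq0]
  have hy' : |y * q - s| ≤ ρ := hy
  nlinarith

/-- The state at `j` only sees the potential at walk positions `1, …, j`, so it does not depend on
`y`. The residual is affine in `y` with slope at least `1 / B` in modulus, which confines `y` to an
interval of length `2 * (B * (B * x))`. -/
theorem constraintSet_slice_le {κ : Type*} [DecidableEq κ] {ν : Measure ℝ} {k : ℝ≥0∞} (hν : ν ≤ k • volume)
    {c μ lam : ℝ} {b t : ℕ → ℝ} {site : ℕ → κ} {N : ℕ} (hsite : Set.InjOn site (Set.Icc 1 N))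
    {r B x : ℝ} (hBx : 0 ≤ B * x) {j : ℕ} (hj : j < N) (v : κ → ℝ) :
    ν {y | Function.update v (site (j + 1)) y ∈ constraintSet c μ lam b t site r B x j} ≤
      k * ENNReal.ofReal (2 * (B * (B * x))) := by
  have hst : ∀ y, chainState c μ lam b t
      (fun i => Function.update v (site (j + 1)) y (site i)) r j =
      chainState c μ lam b t (fun i => v (site i)) r j := by
    intro y
    refine chainState_congr fun i h1 h2 => ?_
    rw [Function.update_of_ne]
    intro h
    have := hsite (Set.mem_Icc.2 ⟨h1, by omega⟩) (Set.mem_Icc.2 ⟨by omega, hj⟩) h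
    omega
  set p := chainState c μ lam b t (fun i => v (site i)) r j with hp
  refine (hν _).trans ?_
  rw [Measure.smul_apply, smul_eq_mul]
  gcongr
  by_cases hq : 1 ≤ B * |p.2|
  · refine le_trans (measure_mono fun y hy => ?_) (volume_abs_mul_sub_le (s := μ * p.2 +
      lam * b j * p.1 + if t (j + 1) = 0 then 0 else lam * b (j + 1) * chainDrift c b t j p) hq hBx)
    have h2 := hy.2
    rw [hst, Function.update_self] at h2
    refine le_trans (le_of_eq ?_) h2
    congr 1
    unfold chainResidual
    ring
  · have : {y | Function.update v (site (j + 1)) y ∈ constraintSet c μ lam b t site r B x j} = ∅ := by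
      ext y
      simp only [Set.mem_ofPred_eq, Set.mem_empty_iff_false, iff_false]
      intro hy
      have h1 := hy.1
      rw [hst] at h1
      exact hq h1
    rw [this]; simp

/-- Induction on the blocks of three, integrating out the site of the last constraint first: earlier
constraints do not involve it. The factor `3` counts its possible positions in the block. -/
theorem pi_forall_constraintSet_le (ν : Measure ℝ) [IsProbabilityMeasure ν] {k : ℝ≥0∞}
    (hν : ν ≤ k • volume) (c μ lam : ℝ) (b t : ℕ → ℝ) {site : ℕ → ι} {N : ℕ}
    (hsite : Set.InjOn site (Set.Icc 1 N)) (r : ℝ) {B x : ℝ} (hBx : 0 ≤ B * x) {w : ℕ}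
    (hw : 3 * w ≤ N) :
    Measure.pi (fun _ : ι => ν) {v | ∀ i < w, ∃ j, 3 * i ≤ j ∧ j < 3 * i + 3 ∧
      v ∈ constraintSet c μ lam b t site r B x j} ≤
    (3 * (k * ENNReal.ofReal (2 * (B * (B * x))))) ^ w := by
  induction w with
  | zero => simp
  | succ w ih =>
    set δ := k * ENNReal.ofReal (2 * (B * (B * x))) with hδ
    set G : Set (ι → ℝ) := {v | ∀ i < w, ∃ j, 3 * i ≤ j ∧ j < 3 * i + 3 ∧
      v ∈ constraintSet c μ lam b t site r B x j} with hG
    have hGm : MeasurableSet G := by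
      have : G = ⋂ i ∈ Finset.range w, ⋃ j ∈ Finset.Ico (3 * i) (3 * i + 3),
          constraintSet c μ lam b t site r B x j := by
        ext v; simp [hG, and_assoc]
      rw [this]
      exact Finset.measurableSet_biInter _ fun i _ => Finset.measurableSet_biUnion _ fun j _ =>
        measurableSet_constraintSet _ _ _ _ _ _ _ _ _ _
    have hone : ∀ j, 3 * w ≤ j → j < 3 * w + 3 → Measure.pi (fun _ : ι => ν)
        (constraintSet c μ lam b t site r B x j ∩ G) ≤ δ * Measure.pi (fun _ : ι => ν) G := by
      intro j h1 h2
      refine pi_inter_le ν (measurableSet_constraintSet _ _ _ _ _ _ _ _ _ _) hGm (site (j + 1))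
        (fun v y hv i hi => ?_) (constraintSet_slice_le hν hsite hBx (by omega))
      obtain ⟨j', hj1, hj2, hj3⟩ := hv i hi
      refine ⟨j', hj1, hj2, ?_⟩
      have hne : ∀ i', 1 ≤ i' → i' ≤ j' + 1 →
          Function.update v (site (j + 1)) y (site i') = v (site i') := by
        intro i' hi1 hi2
        rw [Function.update_of_ne]
        intro h
        have := hsite (Set.mem_Icc.2 ⟨hi1, by omega⟩) (Set.mem_Icc.2 ⟨by omega, by omega⟩) h
        omega
      have hst : chainState c μ lam b t
          (fun i => Function.update v (site (j + 1)) y (site i)) r j' =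
          chainState c μ lam b t (fun i => v (site i)) r j' :=
        chainState_congr fun i' hi1 hi2 => hne i' hi1 (by omega)
      have h3 := hj3
      simp only [constraintSet, Set.mem_ofPred_eq] at h3 ⊢
      rwa [hst, hne (j' + 1) (by omega) le_rfl] at h3
    have hsub : {v | ∀ i < w + 1, ∃ j, 3 * i ≤ j ∧ j < 3 * i + 3 ∧
        v ∈ constraintSet c μ lam b t site r B x j} ⊆
        ⋃ j ∈ Finset.Ico (3 * w) (3 * w + 3), (constraintSet c μ lam b t site r B x j ∩ G) := by
      intro v hv
      obtain ⟨j, h1, h2, h3⟩ := hv w (by omega)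
      simp only [Set.mem_iUnion, Finset.mem_Ico]
      exact ⟨j, ⟨h1, h2⟩, h3, fun i hi => hv i (by omega)⟩
    calc _ ≤ ∑ j ∈ Finset.Ico (3 * w) (3 * w + 3), Measure.pi (fun _ : ι => ν)
          (constraintSet c μ lam b t site r B x j ∩ G) :=
          (measure_mono hsub).trans (measure_biUnion_finset_le _ _)
      _ ≤ ∑ j ∈ Finset.Ico (3 * w) (3 * w + 3), δ * (3 * δ) ^ w := by
          refine Finset.sum_le_sum fun j hj => ?_
          rw [Finset.mem_Ico] at hj
          refine (hone j hj.1 hj.2).trans ?_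
          gcongr
          exact ih (by omega)
      _ = (3 * δ) ^ (w + 1) := by simp; ring

/-- Chains are rare. -/
theorem pi_isChain_le (ν : Measure ℝ) [IsProbabilityMeasure ν] {k : ℝ} (hk : 0 ≤ k)
    (hν : ν ≤ ENNReal.ofReal k • volume) (H c μ lam : ℝ) (b : ℕ → ℝ) {site : ℕ → ι} {N : ℕ}
    (hsite : Set.InjOn site (Set.Icc 1 N)) (t₁ t₂ : ℝ) {x : ℝ} (hx0 : 0 < x)
    (hx : x * (4 * (3 * H ^ 4) ^ (2 * N + 2)) ≤ 1) (hx1 : x ≤ 1) {w : ℕ} (hw : 3 * w ≤ N) :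
    Measure.pi (fun _ : ι => ν) {v | ∃ S ∈ (Finset.range (N + 1)).powerset, ∃ f : ℕ → ℝ,
      |f 1| ≤ 1 ∧ IsChain H c μ lam N b (fun i => if i ∈ S then t₁ else t₂)
        (fun i => v (site i)) f x} ≤
    ENNReal.ofReal (2 ^ (N + 1) * (6 / x *
      (6 * k * (4 * (3 * H ^ 4) ^ (N + 1)) ^ 2 * x) ^ w)) := by
  classical
  set B : ℝ := 4 * (3 * H ^ 4) ^ (N + 1) with hB
  have hB0 : 0 ≤ B := by positivity
  -- The second initial value `f 1 ∈ [-1, 1]` depends on the potential. Rounding it down to a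
  -- multiple of `x` makes the initial data deterministic, at the price of `O(1/x)` grid points.
  set R : Finset ℤ := Finset.Icc (-⌈1 / x⌉ - 1) ⌈1 / x⌉ with hR
  let T : Finset ℕ → ℕ → ℝ := fun S i => if i ∈ S then t₁ else t₂
  have hsub : {v | ∃ S ∈ (Finset.range (N + 1)).powerset, ∃ f : ℕ → ℝ, |f 1| ≤ 1 ∧
      IsChain H c μ lam N b (T S) (fun i => v (site i)) f x} ⊆
      ⋃ S ∈ (Finset.range (N + 1)).powerset, ⋃ z ∈ R,
        {v | ∀ i < w, ∃ j, 3 * i ≤ j ∧ j < 3 * i + 3 ∧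
          v ∈ constraintSet c μ lam b (T S) site (z * x) B x j} := by
    rintro v ⟨S, hS, f, hf1, hf⟩
    simp only [Set.mem_iUnion]
    refine ⟨S, hS, ⌊f 1 / x⌋, ?_, fun i hi => ?_⟩
    · obtain ⟨hl, hu⟩ := abs_le.1 hf1
      rw [hR, Finset.mem_Icc]
      constructor
      · have h1 : -(1 / x) ≤ f 1 / x := by
          rw [← neg_div]; gcongr
        have h2 := Int.le_ceil (1 / x)
        have h3 : ((-⌈1 / x⌉ - 1 : ℤ) : ℝ) ≤ f 1 / x := by push_cast; linarith
        exact Int.le_floor.2 h3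
      · have h1 : f 1 / x ≤ 1 / x := by gcongr
        have h2 := Int.floor_le (f 1 / x)
        have h3 := Int.le_ceil (1 / x)
        exact_mod_cast (h2.trans h1).trans h3
    · have hr : |(⌊f 1 / x⌋ : ℝ) * x - f 1| ≤ x := by
        have h2 := Int.floor_le (f 1 / x)
        have h3 := Int.lt_floor_add_one (f 1 / x)
        rw [le_div_iff₀ hx0] at h2
        rw [div_lt_iff₀ hx0] at h3
        rw [abs_le]; constructor <;> linarith
      obtain ⟨j, h1, h2, h3⟩ := hf.exists_constraint hr hx (i := 3 * i) (by omega)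
      exact ⟨j, h1, h2, h3⟩
  have hcard : (R.card : ℝ) ≤ 6 / x := by
    have h1 : 1 ≤ 1 / x := by rw [le_div_iff₀ hx0]; linarith
    have h2 : (0 : ℤ) < ⌈1 / x⌉ := Int.ceil_pos.2 (by linarith)
    have h3 := Int.ceil_lt_add_one (1 / x)
    have h4 : (R.card : ℤ) = 2 * ⌈1 / x⌉ + 2 := by
      rw [hR, Int.card_Icc, Int.toNat_of_nonneg (by omega)]; ring
    have h5 : (R.card : ℝ) = 2 * (⌈1 / x⌉ : ℝ) + 2 := by exact_mod_cast h4
    have h6 : 6 / x = 6 * (1 / x) := by ring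
    rw [h5, h6]; linarith
  have hone : ∀ S (z : ℤ), Measure.pi (fun _ : ι => ν) {v | ∀ i < w, ∃ j, 3 * i ≤ j ∧
      j < 3 * i + 3 ∧ v ∈ constraintSet c μ lam b (T S) site (z * x) B x j} ≤
      ENNReal.ofReal ((6 * k * B ^ 2 * x) ^ w) := by
    intro S z
    refine (pi_forall_constraintSet_le ν hν c μ lam b (T S) hsite _ (by positivity) hw).trans_eq ?_
    rw [ENNReal.ofReal_pow (by positivity), ← ENNReal.ofReal_mul hk]
    congr 1
    rw [show (3 : ℝ≥0∞) = ENNReal.ofReal 3 by simp, ← ENNReal.ofReal_mul (by norm_num)]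
    congr 1
    ring
  calc _ ≤ ∑ S ∈ (Finset.range (N + 1)).powerset, ∑ z ∈ R, ENNReal.ofReal
        ((6 * k * B ^ 2 * x) ^ w) := by
        refine (measure_mono hsub).trans ((measure_biUnion_finset_le _ _).trans ?_)
        refine Finset.sum_le_sum fun S _ => (measure_biUnion_finset_le _ _).trans ?_
        exact Finset.sum_le_sum fun z _ => hone S z
    _ = ENNReal.ofReal (2 ^ (N + 1) * (R.card * (6 * k * B ^ 2 * x) ^ w)) := by
        simp only [Finset.sum_const, Finset.card_powerset, Finset.card_range, nsmul_eq_mul]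
        rw [ENNReal.ofReal_mul (by positivity), ENNReal.ofReal_mul (by positivity)]
        simp
    _ ≤ _ := by
        apply ENNReal.ofReal_le_ofReal
        gcongr

/-! ### From nearly equal moduli to a chain -/

/-- `(|g| - |f|)² ≤ |f² - g²|`. The square root lost here is why squares are compared at the scale
`κ²`. -/
theorem exists_sign_abs_sub_le {f g κ : ℝ} (hκ : 0 ≤ κ) (h : |f ^ 2 - g ^ 2| ≤ κ ^ 2) :
    ∃ s : ℝ, (s = 1 ∨ s = -1) ∧ |g - s * f| ≤ κ := by
  have key : |(|g| - |f|)| ≤ κ := by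
    refine abs_le_of_sq_le_sq ?_ hκ
    have h1 : |(|g| - |f|)| * |(|g| - |f|)| ≤ |(|g| - |f|)| * (|g| + |f|) := by
      gcongr
      rw [abs_le]
      constructor <;> linarith [abs_nonneg g, abs_nonneg f]
    have h2 : |(|g| - |f|)| * (|g| + |f|) = |f ^ 2 - g ^ 2| := by
      rw [← abs_of_nonneg (add_nonneg (abs_nonneg g) (abs_nonneg f)), ← abs_mul, abs_sub_comm,
        ← sq_abs f, ← sq_abs g]
      congr 1; ring
    rw [abs_mul_abs_self] at h1
    nlinarith
  rcases abs_cases g with ⟨hg, _⟩ | ⟨hg, _⟩ <;> rcases abs_cases f with ⟨hf, _⟩ | ⟨hf, _⟩ <;>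
    rw [hg, hf] at key
  · exact ⟨1, Or.inl rfl, by rwa [one_mul]⟩
  · refine ⟨-1, Or.inr rfl, ?_⟩
    rwa [neg_one_mul]
  · refine ⟨-1, Or.inr rfl, ?_⟩
    rw [← abs_neg]; convert key using 2; ring
  · refine ⟨1, Or.inl rfl, ?_⟩
    rw [← abs_neg]; convert key using 2; ring

/-- Two solutions of difference equations with the same potential and nearly the same modulus make
up a chain. -/
theorem exists_isChain {H lam lam' μ μ' E E' κ : ℝ} {N : ℕ} {b W f g : ℕ → ℝ} (hH : 1 ≤ H)
    (hκ : 0 < κ) (hκ1 : κ ≤ 1) (hb : ∀ i ≤ N, |b i| ≤ H ∧ 1 ≤ H * |b i|)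
    (hlam : |lam| ≤ H ∧ 1 ≤ H * |lam|) (hlam' : |lam'| ≤ H)
    (hgap : |μ - μ'| ≤ H ∧ (μ - μ' ≠ 0 → 1 ≤ H * |μ - μ'|))
    (hlink : ∀ t, t = lam' - lam ∨ t = -lam' - lam →
      |t| ≤ H ∧ (t ≠ 0 → 1 ≤ H * |t|) ∧ (t = 0 → μ - μ' ≠ 0))
    (hW : ∀ i < N, |W (i + 1) - μ| ≤ H ∧ |W (i + 1) - μ'| ≤ H)
    (hE : |E - μ| ≤ κ) (hE' : |E' - μ'| ≤ κ) (hf0 : f 0 = 1) (hf : ∀ i ≤ N + 1, |f i| ≤ 1)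
    (hfg : ∀ i ≤ N + 1, |f i ^ 2 - g i ^ 2| ≤ κ ^ 2)
    (heq : ∀ i < N, (W (i + 1) - E) * f (i + 1) = lam * (b (i + 1) * f (i + 2) + b i * f i))
    (heq' : ∀ i < N, (W (i + 1) - E') * g (i + 1) = lam' * (b (i + 1) * g (i + 2) + b i * g i)) :
    ∃ S ∈ (Finset.range (N + 1)).powerset,
      IsChain H (μ - μ') μ lam N b (fun i => if i ∈ S then lam' - lam else -lam' - lam) W f
        (6 * H ^ 2 * κ) := by
  classical
  have hs : ∀ i, ∃ s : ℝ, (s = 1 ∨ s = -1) ∧ (i ≤ N + 1 → |g i - s * f i| ≤ κ) := by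
    intro i
    by_cases hi : i ≤ N + 1
    · obtain ⟨s, h1, h2⟩ := exists_sign_abs_sub_le hκ.le (hfg i hi)
      exact ⟨s, h1, fun _ => h2⟩
    · exact ⟨1, Or.inl rfl, fun h => absurd h hi⟩
  choose s hs1 hs2 using hs
  have hss : ∀ i, s i * s i = 1 := fun i => by rcases hs1 i with h | h <;> rw [h] <;> norm_num
  have habs : ∀ i, |s i| = 1 := fun i => by rcases hs1 i with h | h <;> rw [h] <;> norm_num
  -- Only the relative sign of neighbours enters the free equation, so `S` records the links where
  -- the signs agree.
  set S := (Finset.range (N + 1)).filter fun i => s i * s (i + 1) = 1 with hS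
  set t : ℕ → ℝ := fun i => if i ∈ S then lam' - lam else -lam' - lam with ht
  have htt : ∀ i ≤ N, t i = lam' * (s i * s (i + 1)) - lam := by
    intro i hi
    by_cases h : s i * s (i + 1) = 1
    · have hiS : i ∈ S := by rw [hS, Finset.mem_filter, Finset.mem_range]; exact ⟨by omega, h⟩
      simp only [ht, hiS, if_true, h, mul_one]
    · have hiS : i ∉ S := by rw [hS, Finset.mem_filter]; exact fun h' => h h'.2
      have h' : s i * s (i + 1) = -1 := by
        have h1 : (s i * s (i + 1) - 1) * (s i * s (i + 1) + 1) = 0 := by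
          linear_combination s (i + 1) * s (i + 1) * hss i + hss (i + 1)
        rcases mul_eq_zero.1 h1 with h2 | h2
        · exact absurd (by linarith) h
        · linarith
      simp only [ht, hiS, if_false, h']; ring
  have hκx : κ ≤ 6 * H ^ 2 * κ := by
    refine le_mul_of_one_le_left hκ.le ?_
    nlinarith
  refine ⟨S, Finset.mem_powerset.2 (Finset.filter_subset _ _), ?_⟩
  constructor
  · exact hH
  · exact hb
  · exact hlam
  · exact hgap
  · intro i _
    refine hlink _ ?_
    by_cases h : i ∈ S
    · left; simp [h]
    · right; simp [h]
  · exact fun i hi => (hW i hi).1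
  · exact hf0
  · intro i hi
    rw [← heq i hi]
    have e : (W (i + 1) - μ) * f (i + 1) - (W (i + 1) - E) * f (i + 1) = (E - μ) * f (i + 1) := by
      ring
    rw [e, abs_mul]
    calc |E - μ| * |f (i + 1)| ≤ κ * 1 := by gcongr; exact hf _ (by omega)
      _ ≤ _ := by rw [mul_one]; exact hκx
  · intro i hi
    change |t (i + 1) * b (i + 1) * f (i + 2) + t i * b i * f i - (μ - μ') * f (i + 1)| ≤ _
    rw [htt i hi.le, htt (i + 1) hi]
    set e₀ := g i - s i * f i with he₀
    set e₁ := g (i + 1) - s (i + 1) * f (i + 1) with he₁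
    set e₂ := g (i + 2) - s (i + 2) * f (i + 2) with he₂
    have b₀ : |e₀| ≤ κ := hs2 i (by omega)
    have b₁ : |e₁| ≤ κ := hs2 (i + 1) (by omega)
    have b₂ : |e₂| ≤ κ := hs2 (i + 2) (by omega)
    have q₁ := heq i hi
    have q₂ := heq' i hi
    have g₀ : g i = s i * f i + e₀ := by rw [he₀]; ring
    have g₁ : g (i + 1) = s (i + 1) * f (i + 1) + e₁ := by rw [he₁]; ring
    have g₂ : g (i + 2) = s (i + 2) * f (i + 2) + e₂ := by rw [he₂]; ring
    rw [g₀, g₁, g₂] at q₂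
    -- The first eigenvalue equation minus `s (i + 1)` times the second: as `s (i + 1) ^ 2 = 1`, the
    -- potential survives only in front of the error `e₁`.
    have hid : (lam' * (s (i + 1) * s (i + 2)) - lam) * b (i + 1) * f (i + 2) +
        (lam' * (s i * s (i + 1)) - lam) * b i * f i - (μ - μ') * f (i + 1) =
        ((E - μ) - (E' - μ')) * f (i + 1) +
        (((W (i + 1) - μ') - (E' - μ')) * (s (i + 1) * e₁) -
        lam' * (s (i + 1) * (b (i + 1) * e₂ + b i * e₀))) := by
      linear_combination q₁ - s (i + 1) * q₂ + (W (i + 1) - E') * f (i + 1) * hss (i + 1)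
    have hid' : (lam' * (s (i + 1) * s (i + 1 + 1)) - lam) * b (i + 1) * f (i + 2) +
        (lam' * (s i * s (i + 1)) - lam) * b i * f i - (μ - μ') * f (i + 1) = _ := hid
    rw [hid']
    have r1 : |((E - μ) - (E' - μ')) * f (i + 1)| ≤ (κ + κ) * 1 := by
      rw [abs_mul]
      gcongr
      · exact (abs_sub _ _).trans (add_le_add hE hE')
      · exact hf _ (by omega)
    have r2 : |((W (i + 1) - μ') - (E' - μ')) * (s (i + 1) * e₁)| ≤ (H + 1) * (1 * κ) := by
      rw [abs_mul, abs_mul, habs]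
      gcongr
      exact (abs_sub _ _).trans (add_le_add (hW i hi).2 (hE'.trans hκ1))
    have r3 : |lam' * (s (i + 1) * (b (i + 1) * e₂ + b i * e₀))| ≤ H * (1 * (H * κ + H * κ)) := by
      rw [abs_mul, abs_mul, habs]
      gcongr
      refine (abs_add_le _ _).trans ?_
      rw [abs_mul, abs_mul]
      gcongr
      exacts [(hb (i + 1) hi).1, (hb i hi.le).1]
    refine (abs_add_le _ _).trans ((add_le_add r1 ((abs_sub _ _).trans (add_le_add r2 r3))).trans ?_)
    nlinarith [mul_nonneg (sub_nonneg.2 hH) hκ.le, mul_nonneg (mul_nonneg (sub_nonneg.2 hH) (by linarith : 0 ≤ H)) hκ.le]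
  · positivity

/-! ### The operator on the box -/

/-- Extension by zero of a vector on the box. -/
def extendZero {l : ℕ} (φ : Box l → ℝ) (n : ℤ) : ℝ :=
  if h : n ∈ Finset.Icc (1 : ℤ) l then φ ⟨n, h⟩ else 0

theorem extendZero_coe {l : ℕ} (φ : Box l → ℝ) (n : Box l) : extendZero φ n = φ n := by
  simp only [extendZero]
  rw [dif_pos n.2]

theorem sum_single_mul {l : ℕ} (φ : Box l → ℝ) (j : ℤ) :
    ∑ n : Box l, (Pi.single (n : ℤ) (1 : ℝ) : ℤ → ℝ) j * φ n = extendZero φ j := by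
  unfold extendZero
  split_ifs with h
  · rw [Finset.sum_eq_single (⟨j, h⟩ : Box l)]
    · simp
    · intro n _ hn
      have : j ≠ n := fun hj => hn (Subtype.ext hj.symm)
      simp [this]
    · simp
  · refine Finset.sum_eq_zero fun n _ => ?_
    have : j ≠ n := fun hj => h (hj ▸ n.2)
    simp [this]

theorem boxOp_mulVec (a V : ℤ → ℝ) {l : ℕ} (φ : Box l → ℝ) (m : Box l) :
    (boxOp a V l *ᵥ φ) m = jacobiOp a V (extendZero φ) m := by
  simp only [Matrix.mulVec, dotProduct, boxOp, Matrix.of_apply, jacobiOp, hopping]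
  rw [← sum_single_mul φ (m + 1), ← sum_single_mul φ (m - 1), ← sum_single_mul φ m, Finset.mul_sum,
    Finset.mul_sum, Finset.mul_sum, ← Finset.sum_add_distrib, ← Finset.sum_neg_distrib,
    ← Finset.sum_add_distrib]
  exact Finset.sum_congr rfl fun n _ => by ring

/-- The hopping part of the operator, multiplied by a coupling constant. -/
def hopMatrix (a : ℤ → ℝ) (lam : ℝ) (l : ℕ) : Matrix (Box l) (Box l) ℝ := lam • boxOp a 0 l

theorem hopMatrix_isHermitian (a : ℤ → ℝ) (lam : ℝ) (l : ℕ) : (hopMatrix a lam l).IsHermitian := by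
  have := boxOp_isHermitian a 0 l
  simp only [Matrix.IsHermitian, hopMatrix, Matrix.conjTranspose_smul, star_trivial] at this ⊢
  rw [this]

theorem hopMatrix_add_diagonal_mulVec (a : ℤ → ℝ) (lam : ℝ) {l : ℕ} (V φ : Box l → ℝ) (m : Box l) :
    ((hopMatrix a lam l + Matrix.diagonal V) *ᵥ φ) m =
      -(lam * (a (m + 1) * extendZero φ (m + 1) + a m * extendZero φ (m - 1))) + V m * φ m := by
  rw [Matrix.add_mulVec, Pi.add_apply, Matrix.mulVec_diagonal, hopMatrix, Matrix.smul_mulVec,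
    Pi.smul_apply, boxOp_mulVec]
  simp [jacobiOp, hopping]
  ring

/-- The three-term recurrence, started from the Dirichlet value `0` at site `0`, shows that a kernel
vector vanishing at site `1` is zero. Apply this to the combination of two kernel vectors that
vanishes there. -/
theorem simpleKernel_hopMatrix {a : ℤ → ℝ} (ha : ∀ n, a n ≠ 0) {lam : ℝ} (hlam : lam ≠ 0) (l : ℕ) :
    SimpleKernel (hopMatrix a lam l) := by
  have hzero : ∀ V φ : Box l → ℝ, (hopMatrix a lam l + Matrix.diagonal V) *ᵥ φ = 0 →
      extendZero φ 1 = 0 → φ = 0 := by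
    intro V φ h h1
    have hall : ∀ n : ℕ, n ≤ l → extendZero φ n = 0 ∧ (n + 1 ≤ l → extendZero φ (n + 1) = 0) := by
      intro n hn
      induction n with
      | zero => exact ⟨by simp [extendZero], fun _ => by simpa using h1⟩
      | succ n ih =>
        obtain ⟨h2, h3⟩ := ih (by omega)
        have h4 := h3 hn
        refine ⟨by exact_mod_cast h4, fun h5 => ?_⟩
        have hm : ((n : ℤ) + 1) ∈ Finset.Icc (1 : ℤ) l := by rw [Finset.mem_Icc]; omega
        have h6 := congrFun h ⟨(n : ℤ) + 1, hm⟩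
        rw [hopMatrix_add_diagonal_mulVec] at h6
        have h7 : φ ⟨(n : ℤ) + 1, hm⟩ = 0 := by rw [← extendZero_coe φ]; exact h4
        have h8 : (n : ℤ) + 1 - 1 = n := by ring
        rw [h7] at h6
        simp only [h8, h2, mul_zero, add_zero, Pi.zero_apply, neg_eq_zero, mul_eq_zero, hlam,
          ha, false_or] at h6
        exact_mod_cast h6
    ext n
    rw [← extendZero_coe φ]
    obtain ⟨n, hn⟩ := n
    rw [Finset.mem_Icc] at hn
    have := (hall n.toNat (by omega)).1
    rwa [Int.toNat_of_nonneg (by omega)] at this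
  intro V φ ψ hφ hψ i j
  have hadd : ∀ x y : ℝ, extendZero (x • ψ - y • φ) 1 = x * extendZero ψ 1 - y * extendZero φ 1 := by
    intro x y
    unfold extendZero
    split_ifs <;> simp
  by_cases h : extendZero φ 1 = 0
  · rw [hzero V φ hφ h]; simp
  · have hw := hzero V (extendZero φ 1 • ψ - extendZero ψ 1 • φ) (by
      rw [Matrix.mulVec_sub, Matrix.mulVec_smul, Matrix.mulVec_smul, hφ, hψ]; simp)
      (by rw [hadd]; ring)
    have hi := congrFun hw i
    have hj := congrFun hw j
    simp only [Pi.sub_apply, Pi.smul_apply, smul_eq_mul, Pi.zero_apply] at hi hj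
    apply mul_left_cancel₀ h
    linear_combination φ i * hj - φ j * hi

/-- If the trace of the spectral projection does not vanish, there is an eigenvalue in the set. -/
theorem exists_isEigenpair_of_trSpectralProj_ne_zero {a V : ℤ → ℝ} {l : ℕ} {lam mu : ℝ → ℝ}
    {E : ℝ} (hE : lam E ≠ 0) {J : Set ℝ}
    (h : trSpectralProj a (potentialAt lam mu E V) l J ≠ 0) :
    ∃ e ∈ J, ∃ φ, IsEigenpair (hopMatrix a (lam E) l) (fun n : Box l => V n) (mu E + lam E * e) φ := by
  classical
  set A := boxOp a (potentialAt lam mu E V) l with hA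
  have hH := boxOp_isHermitian a (potentialAt lam mu E V) l
  have htr : trSpectralProj a (potentialAt lam mu E V) l J =
      ∑ i, J.indicator 1 (hH.eigenvalues i) := by
    unfold trSpectralProj Matrix.IsHermitian.cfc
    rw [Unitary.conjStarAlgAut_apply, Matrix.trace_mul_comm, ← mul_assoc]
    simp [Matrix.trace_diagonal]
  rw [htr] at h
  obtain ⟨i, -, hi⟩ := Finset.exists_ne_zero_of_sum_ne_zero h
  have hmem : hH.eigenvalues i ∈ J := by
    by_contra hn
    exact hi (Set.indicator_of_notMem hn _)
  refine ⟨_, hmem, (hH.eigenvectorBasis i).ofLp, ?_, ?_⟩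
  · have hv := hH.mulVec_eigenvectorBasis i
    ext m
    have hm := congrFun hv m
    rw [boxOp_mulVec] at hm
    rw [hopMatrix_add_diagonal_mulVec]
    simp only [jacobiOp, hopping, potentialAt, Pi.smul_apply, smul_eq_mul, extendZero_coe] at hm ⊢
    have h2 : lam E * ((V m - mu E) / lam E) = V m - mu E := by field_simp
    linear_combination lam E * hm - (hH.eigenvectorBasis i).ofLp m * h2
  · have h2 := EuclideanSpace.real_norm_sq_eq (hH.eigenvectorBasis i)
    rw [hH.eigenvectorBasis.orthonormal.1 i] at h2
    simpa using h2.symm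

theorem card_box (l : ℕ) : Fintype.card (Box l) = l := by simp

/-- The sites of a box that are met when walking from `n` in the direction `σ`. -/
def walkSite {l : ℕ} (n : Box l) (σ : ℤ) (i : ℕ) : Box l :=
  if h : (n : ℤ) + σ * i ∈ Finset.Icc (1 : ℤ) l then ⟨n + σ * i, h⟩ else n

/-- The hopping terms that are met when walking from `n` in the direction `σ`. -/
def walkHop (a : ℤ → ℝ) (n σ : ℤ) (i : ℕ) : ℝ := a (max (n + σ * i) (n + σ * (i + 1)))

theorem coe_walkSite {l : ℕ} {n : Box l} {σ : ℤ} {i : ℕ}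
    (h : (n : ℤ) + σ * i ∈ Finset.Icc (1 : ℤ) l) : ((walkSite n σ i : Box l) : ℤ) = n + σ * i := by
  unfold walkSite; rw [dif_pos h]

/-- The bond between `m` and `m + 1` carries `a (m + 1)`, the value at its larger endpoint; this is
the `max` in `walkHop` and gives the equation the same form in both directions. Room up to `N + 1`
keeps the boundary out of it. -/
theorem walk_equation {a : ℤ → ℝ} {lam E : ℝ} {l : ℕ} {v φ : Box l → ℝ}
    (h : IsEigenpair (hopMatrix a lam l) v E φ) {n : Box l} {σ : ℤ} (hσ : σ = 1 ∨ σ = -1) {N : ℕ}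
    (hroom : ∀ i : ℕ, i ≤ N + 1 → (n : ℤ) + σ * i ∈ Finset.Icc (1 : ℤ) l) {i : ℕ} (hi : i < N) :
    (v (walkSite n σ (i + 1)) - E) * φ (walkSite n σ (i + 1)) =
      lam * (walkHop a n σ (i + 1) * φ (walkSite n σ (i + 2)) +
        walkHop a n σ i * φ (walkSite n σ i)) := by
  have h1 := congrFun h.1 (walkSite n σ (i + 1))
  rw [hopMatrix_add_diagonal_mulVec, Pi.smul_apply, smul_eq_mul,
    coe_walkSite (hroom (i + 1) (by omega))] at h1
  rw [← extendZero_coe φ (walkSite n σ (i + 2)), ← extendZero_coe φ (walkSite n σ i),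
    coe_walkSite (hroom (i + 2) (by omega)), coe_walkSite (hroom i (by omega))]
  unfold walkHop
  rcases hσ with rfl | rfl
  · have e1 : max ((n : ℤ) + 1 * ((i + 1 : ℕ) : ℤ)) (n + 1 * (((i + 1 : ℕ) : ℤ) + 1)) =
        n + 1 * ((i + 1 : ℕ) : ℤ) + 1 := by push_cast; omega
    have e2 : max ((n : ℤ) + 1 * (i : ℤ)) (n + 1 * ((i : ℤ) + 1)) =
        n + 1 * ((i + 1 : ℕ) : ℤ) := by push_cast; omega
    have e3 : (n : ℤ) + 1 * ((i + 1 : ℕ) : ℤ) + 1 = n + 1 * ((i + 2 : ℕ) : ℤ) := by push_cast; ring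
    have e4 : (n : ℤ) + 1 * ((i + 1 : ℕ) : ℤ) - 1 = n + 1 * (i : ℤ) := by push_cast; ring
    rw [e1, e2]
    rw [e4, e3] at h1
    rw [e3]
    linear_combination h1
  · have e1 : max ((n : ℤ) + -1 * ((i + 1 : ℕ) : ℤ)) (n + -1 * (((i + 1 : ℕ) : ℤ) + 1)) =
        n + -1 * ((i + 1 : ℕ) : ℤ) := by push_cast; omega
    have e2 : max ((n : ℤ) + -1 * (i : ℤ)) (n + -1 * ((i : ℤ) + 1)) =
        n + -1 * ((i + 1 : ℕ) : ℤ) + 1 := by push_cast; omega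
    have e3 : (n : ℤ) + -1 * ((i + 1 : ℕ) : ℤ) + 1 = n + -1 * (i : ℤ) := by push_cast; ring
    have e4 : (n : ℤ) + -1 * ((i + 1 : ℕ) : ℤ) - 1 = n + -1 * ((i + 2 : ℕ) : ℤ) := by
      push_cast; ring
    rw [e1, e2]
    rw [e4, e3] at h1
    rw [e3]
    linear_combination h1

/-! ### The dichotomy for pairs of eigenvectors -/

/-- Since both families sum to one, `p n - q n = ∑ m, (p n * q m - p m * q n)`, and some term is at
least the average. -/
theorem exists_transversal_sites {ι : Type*} [Fintype ι] {p q : ι → ℝ} (hp : ∑ i, p i = 1)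
    (hq : ∑ i, q i = 1) {n : ι} {δ : ℝ} (h : δ < |p n - q n|) :
    ∃ m, δ / Fintype.card ι ≤ |p n * q m - p m * q n| := by
  by_contra! hlt
  have e : p n - q n = ∑ m, (p n * q m - p m * q n) := by
    rw [Finset.sum_sub_distrib, ← Finset.mul_sum, ← Finset.sum_mul, hp, hq]; ring
  have hne : Nonempty ι := ⟨n⟩
  have hc : (0 : ℝ) < Fintype.card ι := by exact_mod_cast Fintype.card_pos
  have : |p n - q n| ≤ δ := by
    rw [e]
    calc _ ≤ ∑ m, |p n * q m - p m * q n| := Finset.abs_sum_le_sum_abs _ _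
      _ ≤ ∑ _m : ι, δ / Fintype.card ι := Finset.sum_le_sum fun m _ => (hlt m).le
      _ = δ := by simp; field_simp
  linarith

section Decorrelation

variable {a : ℤ → ℝ} {H lam lam' μ μ' : ℝ}

/-- The walk starts at a maximum of `|φ|`: dividing by `φ n` gives `f 0 = 1` and `|f| ≤ 1`, and
turns the relative closeness of the squares into an absolute one. -/
theorem exists_chain_of_eigenpairs (hH : 1 ≤ H)
    (ha : ∀ n, |a n| ≤ H ∧ 1 ≤ H * |a n|) (hlam : |lam| ≤ H ∧ 1 ≤ H * |lam|) (hlam' : |lam'| ≤ H)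
    (hgap : |μ - μ'| ≤ H ∧ (μ - μ' ≠ 0 → 1 ≤ H * |μ - μ'|))
    (hlink : ∀ t, t = lam' - lam ∨ t = -lam' - lam →
      |t| ≤ H ∧ (t ≠ 0 → 1 ≤ H * |t|) ∧ (t = 0 → μ - μ' ≠ 0))
    {κ : ℝ} (hκ : 0 < κ) (hκ1 : κ ≤ 1) {l : ℕ} {v φ φ' : Box l → ℝ} {E E' : ℝ}
    (hv : ∀ n, |v n - μ| ≤ H ∧ |v n - μ'| ≤ H) (hE : |E - μ| ≤ κ) (hE' : |E' - μ'| ≤ κ)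
    (h : IsEigenpair (hopMatrix a lam l) v E φ) (h' : IsEigenpair (hopMatrix a lam' l) v E' φ')
    {n : Box l} {σ : ℤ} (hσ : σ = 1 ∨ σ = -1) {N : ℕ}
    (hroom : ∀ i : ℕ, i ≤ N + 1 → (n : ℤ) + σ * i ∈ Finset.Icc (1 : ℤ) l)
    (hn0 : φ n ≠ 0) (hmax : ∀ m, φ m ^ 2 ≤ φ n ^ 2)
    (hclose : ∀ m, |φ m ^ 2 - φ' m ^ 2| ≤ κ ^ 2 * φ n ^ 2) :
    ∃ S ∈ (Finset.range (N + 1)).powerset, ∃ f : ℕ → ℝ, |f 1| ≤ 1 ∧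
      IsChain H (μ - μ') μ lam N (walkHop a n σ) (fun i => if i ∈ S then lam' - lam else -lam' - lam)
        (fun i => v (walkSite n σ i)) f (6 * H ^ 2 * κ) := by
  have hsq : 0 < φ n ^ 2 := by positivity
  have hf : ∀ m, |φ m / φ n| ≤ 1 := by
    intro m
    rw [abs_div, div_le_one (abs_pos.2 hn0)]
    exact sq_le_sq.1 (hmax m)
  have hs0 : walkSite n σ 0 = n := by
    apply Subtype.ext
    rw [coe_walkSite (hroom 0 (by omega))]; simp
  obtain ⟨S, hS, hchain⟩ := exists_isChain (f := fun i => φ (walkSite n σ i) / φ n)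
    (g := fun i => φ' (walkSite n σ i) / φ n) (W := fun i => v (walkSite n σ i))
    (b := walkHop a n σ) (N := N) hH hκ hκ1 (fun i _ => ha _) hlam hlam' hgap hlink
    (fun i _ => hv _) hE hE' (by simp only [hs0]; exact div_self hn0) (fun i _ => hf _)
    (fun i _ => by
      rw [div_pow, div_pow, ← sub_div, abs_div, abs_of_pos hsq, div_le_iff₀ hsq]
      exact hclose _)
    (fun i hi => by
      have := walk_equation h hσ hroom hi
      field_simp
      linear_combination this)
    (fun i hi => by
      have := walk_equation h' hσ hroom hi
      field_simp
      linear_combination this)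
  exact ⟨S, hS, _, hf _, hchain⟩

/-- The main estimate: the potentials for which the two operators both have an eigenvalue close to
the prescribed energies. -/
theorem pi_eigenpairs_le (hH : 1 ≤ H)
    (ha : ∀ n, |a n| ≤ H ∧ 1 ≤ H * |a n|) (hlam : |lam| ≤ H ∧ 1 ≤ H * |lam|)
    (hlam' : |lam'| ≤ H) (hlam0 : lam' ≠ 0)
    (hgap : |μ - μ'| ≤ H ∧ (μ - μ' ≠ 0 → 1 ≤ H * |μ - μ'|))
    (hlink : ∀ t, t = lam' - lam ∨ t = -lam' - lam →
      |t| ≤ H ∧ (t ≠ 0 → 1 ≤ H * |t|) ∧ (t = 0 → μ - μ' ≠ 0))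
    (ν : Measure ℝ) [IsProbabilityMeasure ν] {k : ℝ} (hk : 0 ≤ k)
    (hν : ν ≤ ENNReal.ofReal k • volume)
    {κ ε : ℝ} (hε : 0 < ε) (hεκ : ε ≤ κ) (hκ1 : 6 * H ^ 2 * κ ≤ 1) {w : ℕ}
    (hκ2 : 6 * H ^ 2 * κ * (4 * (3 * H ^ 4) ^ (2 * (3 * w) + 2)) ≤ 1) {l : ℕ}
    (hl : 2 * (3 * w + 2) ≤ l) :
    Measure.pi (fun _ : Box l => ν) {v | (∀ n, |v n - μ| ≤ H ∧ |v n - μ'| ≤ H) ∧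
      (∃ E ∈ Set.Icc (μ - ε) (μ + ε), ∃ φ, IsEigenpair (hopMatrix a lam l) v E φ) ∧
      ∃ E' ∈ Set.Icc (μ' - ε) (μ' + ε), ∃ φ', IsEigenpair (hopMatrix a lam' l) v E' φ'} ≤
    ENNReal.ofReal (l ^ 2 * (k * (k * (2 * (l ^ 2 / κ ^ 2 * (2 * ε * (2 * ε)))))) +
      2 * l * (2 ^ (3 * w + 1) * (6 / (6 * H ^ 2 * κ) *
        (6 * k * (4 * (3 * H ^ 4) ^ (3 * w + 1)) ^ 2 * (6 * H ^ 2 * κ)) ^ w))) := by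
  classical
  have hκ : 0 < κ := hε.trans_le hεκ
  have hx0 : 0 < 6 * H ^ 2 * κ := by positivity
  have hκle : κ ≤ 1 := by nlinarith
  have hl0 : (0 : ℝ) < l := by exact_mod_cast (by omega : 0 < l)
  have ha0 : ∀ n, a n ≠ 0 := fun n hz => by have := (ha n).2; rw [hz] at this; norm_num at this
  have hlam0' : lam ≠ 0 := fun hz => by have := hlam.2; rw [hz] at this; norm_num at this
  -- One factor `1 / l` bounds the maximum of `φ²` from below, the other comes from the pigeonhole
  -- choice of the second site.
  set τ : ℝ := κ ^ 2 / l / l with hτ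
  have hτ0 : 0 < τ := by positivity
  let room : Box l → ℤ → Prop := fun n σ =>
    ∀ i : ℕ, i ≤ 3 * w + 1 → (n : ℤ) + σ * i ∈ Finset.Icc (1 : ℤ) l
  let X : Box l → Box l → Set (Box l → ℝ) := fun n m =>
    {v | ∃ E ∈ Set.Icc (μ - ε) (μ + ε), ∃ E' ∈ Set.Icc (μ' - ε) (μ' + ε), ∃ φ φ' : Box l → ℝ,
      IsEigenpair (hopMatrix a lam l) v E φ ∧ IsEigenpair (hopMatrix a lam' l) v E' φ' ∧
      τ ≤ |φ n ^ 2 * φ' m ^ 2 - φ m ^ 2 * φ' n ^ 2|}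
  let Y : Box l → ℤ → Set (Box l → ℝ) := fun n σ =>
    {v | room n σ ∧ ∃ S ∈ (Finset.range (3 * w + 1)).powerset, ∃ f : ℕ → ℝ, |f 1| ≤ 1 ∧
      IsChain H (μ - μ') μ lam (3 * w) (walkHop a n σ)
        (fun i => if i ∈ S then lam' - lam else -lam' - lam)
        (fun i => v (walkSite n σ i)) f (6 * H ^ 2 * κ)}
  set bX : ℝ := k * (k * (2 * (l ^ 2 / κ ^ 2 * (2 * ε * (2 * ε))))) with hbX
  set bY : ℝ := 2 ^ (3 * w + 1) * (6 / (6 * H ^ 2 * κ) *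
        (6 * k * (4 * (3 * H ^ 4) ^ (3 * w + 1)) ^ 2 * (6 * H ^ 2 * κ)) ^ w) with hbY
  have hbX0 : 0 ≤ bX := by positivity
  have hbY0 : 0 ≤ bY := by positivity
  have hX : ∀ n m, Measure.pi (fun _ : Box l => ν) (X n m) ≤ ENNReal.ofReal bX := by
    intro n m
    by_cases hnm : n = m
    · have : X n m = ∅ := by
        ext v
        simp only [X, Set.mem_ofPred_eq, Set.mem_empty_iff_false, iff_false]
        rintro ⟨E, -, E', -, φ, φ', -, -, hle⟩
        rw [hnm, sub_self, abs_zero] at hle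
        linarith
      rw [this]; simp
    · refine (pi_eigenpair_pair_le (hopMatrix_isHermitian a lam l) (hopMatrix_isHermitian a lam' l)
        (simpleKernel_hopMatrix ha0 hlam0' l) (simpleKernel_hopMatrix ha0 hlam0 l) ν hν hnm
        _ _ _ _ hτ0).trans_eq ?_
      have e1 : μ + ε - (μ - ε) = 2 * ε := by ring
      have e2 : μ' + ε - (μ' - ε) = 2 * ε := by ring
      have e3 : τ⁻¹ = l ^ 2 / κ ^ 2 := by rw [hτ]; field_simp
      rw [e1, e2, e3, hbX, show (2 : ℝ≥0∞) = ENNReal.ofReal 2 by simp,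
        ← ENNReal.ofReal_mul (by positivity), ← ENNReal.ofReal_mul (by positivity),
        ← ENNReal.ofReal_mul (by positivity), ← ENNReal.ofReal_mul hk, ← ENNReal.ofReal_mul hk]
  have hY : ∀ n, ∀ σ ∈ ({1, -1} : Finset ℤ), Measure.pi (fun _ : Box l => ν) (Y n σ) ≤
      ENNReal.ofReal bY := by
    intro n σ hσ
    have hσ' : σ = 1 ∨ σ = -1 := by simpa using hσ
    by_cases hr : room n σ
    · refine (measure_mono fun v hv => hv.2).trans (pi_isChain_le ν hk hν H (μ - μ') μ lam
        (walkHop a n σ) (site := walkSite n σ) (N := 3 * w) ?_ (lam' - lam) (-lam' - lam) hx0 hκ2 hκ1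
        le_rfl)
      intro i hi j hj hij
      have : ((walkSite n σ i : Box l) : ℤ) = walkSite n σ j := congrArg _ hij
      rw [coe_walkSite (hr i (by have := hi.2; omega)),
        coe_walkSite (hr j (by have := hj.2; omega))] at this
      rcases hσ' with rfl | rfl <;> omega
    · have : Y n σ = ∅ := by
        ext v
        simp only [Y, Set.mem_ofPred_eq, Set.mem_empty_iff_false, iff_false]
        exact fun h => hr h.1
      rw [this]; simp
  have hsub : {v | (∀ n, |v n - μ| ≤ H ∧ |v n - μ'| ≤ H) ∧
      (∃ E ∈ Set.Icc (μ - ε) (μ + ε), ∃ φ, IsEigenpair (hopMatrix a lam l) v E φ) ∧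
      ∃ E' ∈ Set.Icc (μ' - ε) (μ' + ε), ∃ φ', IsEigenpair (hopMatrix a lam' l) v E' φ'} ⊆
      (⋃ n ∈ (Finset.univ : Finset (Box l)), ⋃ m ∈ (Finset.univ : Finset (Box l)), X n m) ∪
      ⋃ n ∈ (Finset.univ : Finset (Box l)), ⋃ σ ∈ ({1, -1} : Finset ℤ), Y n σ := by
    rintro v ⟨hv, ⟨E, hE, φ, hφ⟩, E', hE', φ', hφ'⟩
    have hne : Nonempty (Box l) := ⟨⟨1, by rw [Finset.mem_Icc]; omega⟩⟩
    obtain ⟨n, hn⟩ := Finite.exists_max fun m => φ m ^ 2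
    have hpn : 1 / (l : ℝ) ≤ φ n ^ 2 := by
      rw [div_le_iff₀ hl0]
      calc (1 : ℝ) = ∑ m, φ m ^ 2 := hφ.2.symm
        _ ≤ ∑ _m : Box l, φ n ^ 2 := Finset.sum_le_sum fun m _ => hn m
        _ = φ n ^ 2 * l := by
          rw [Finset.sum_const, Finset.card_univ, card_box, nsmul_eq_mul, mul_comm]
    have hn0 : φ n ≠ 0 := fun hz => by
      rw [hz] at hpn
      have : 0 < 1 / (l : ℝ) := by positivity
      norm_num at hpn; linarith
    by_cases hclose : ∀ m, |φ m ^ 2 - φ' m ^ 2| ≤ κ ^ 2 * φ n ^ 2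
    · right
      -- The maximum may lie near one end of the box, but the walk can go towards the farther end.
      have hdir : ∃ σ : ℤ, (σ = 1 ∨ σ = -1) ∧ room n σ := by
        have hnI := Finset.mem_Icc.1 n.2
        by_cases hh : 2 * (n : ℤ) ≤ l
        · refine ⟨1, Or.inl rfl, fun i hi => ?_⟩
          rw [Finset.mem_Icc]; omega
        · refine ⟨-1, Or.inr rfl, fun i hi => ?_⟩
          rw [Finset.mem_Icc]; omega
      obtain ⟨σ, hσ, hroom⟩ := hdir
      simp only [Set.mem_iUnion]
      refine ⟨n, Finset.mem_univ _, σ, by simpa using hσ, hroom, ?_⟩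
      have hEk : |E - μ| ≤ κ := by
        rw [abs_le]; constructor <;> linarith [hE.1, hE.2]
      have hEk' : |E' - μ'| ≤ κ := by
        rw [abs_le]; constructor <;> linarith [hE'.1, hE'.2]
      exact exists_chain_of_eigenpairs hH ha hlam hlam' hgap hlink hκ hκle hv hEk hEk' hφ hφ' hσ
        hroom hn0 hn hclose
    · left
      push Not at hclose
      obtain ⟨m, hm⟩ := hclose
      have hm' : κ ^ 2 / l < |φ m ^ 2 - φ' m ^ 2| := by
        refine lt_of_le_of_lt ?_ hm
        rw [div_eq_mul_one_div]
        gcongr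
      obtain ⟨m', hm''⟩ := exists_transversal_sites hφ.2 hφ'.2 hm'
      rw [card_box] at hm''
      simp only [Set.mem_iUnion]
      exact ⟨m, Finset.mem_univ _, m', Finset.mem_univ _, E, hE, E', hE', φ, φ', hφ, hφ', hm''⟩
  refine (measure_mono hsub).trans ((measure_union_le _ _).trans ?_)
  clear_value bX bY
  rw [ENNReal.ofReal_add (by positivity) (by positivity)]
  refine add_le_add ?_ ?_
  · calc _ ≤ ∑ _n : Box l, ∑ _m : Box l, ENNReal.ofReal bX := by
          refine (measure_biUnion_finset_le _ _).trans (Finset.sum_le_sum fun n _ => ?_)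
          exact (measure_biUnion_finset_le _ _).trans (Finset.sum_le_sum fun m _ => hX n m)
      _ = ENNReal.ofReal (l ^ 2 * bX) := by
          rw [ENNReal.ofReal_mul (by positivity)]
          simp only [Finset.sum_const, Finset.card_univ, card_box, nsmul_eq_mul]
          rw [ENNReal.ofReal_pow (by positivity), ENNReal.ofReal_natCast]; ring
  · calc _ ≤ ∑ _n : Box l, ∑ _σ ∈ ({1, -1} : Finset ℤ), ENNReal.ofReal bY := by
          refine (measure_biUnion_finset_le _ _).trans (Finset.sum_le_sum fun n _ => ?_)
          exact (measure_biUnion_finset_le _ _).trans (Finset.sum_le_sum fun σ hσ => hY n σ hσ)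
      _ = ENNReal.ofReal (2 * l * bY) := by
          rw [ENNReal.ofReal_mul (by positivity), ENNReal.ofReal_mul (by positivity)]
          simp only [Finset.sum_const, Finset.card_univ, card_box, nsmul_eq_mul]
          rw [Finset.card_pair (by norm_num), ENNReal.ofReal_natCast]
          simp; ring

end Decorrelation

/-! ### The random potential, and asymptotics in `L` -/

/-- Independence makes the law on the box a product measure. The one-sided bound holds for arbitrary
`S`, so measurability of the events never has to be checked here. -/
theorem measure_mem_le_pi {Ω : Type*} [MeasurableSpace Ω] {P : Measure Ω} [IsProbabilityMeasure P]
    {V : ℤ → Ω → ℝ} (hVmeas : ∀ n, Measurable (V n)) (hVindep : iIndepFun V P) {ν : Measure ℝ}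
    (hlaw : ∀ n, P.map (V n) = ν) (l : ℕ) (S : Set (Box l → ℝ)) :
    P {ω | (fun n : Box l => V n ω) ∈ S} ≤ Measure.pi (fun _ : Box l => ν) S := by
  have hind : iIndepFun (fun n : Box l => V n) P := hVindep.precomp Subtype.val_injective
  have hmap := (iIndepFun_iff_map_fun_eq_pi_map fun n : Box l => (hVmeas n).aemeasurable).1 hind
  simp only [hlaw] at hmap
  rw [← hmap]
  exact Measure.le_map_apply
    (measurable_pi_lambda (fun ω (n : Box l) => V n ω) fun n => hVmeas n).aemeasurable S

theorem ae_abs_le_of_hasCompactSupport {Ω : Type*} [MeasurableSpace Ω] {P : Measure Ω}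
    {V : ℤ → Ω → ℝ} (hVmeas : ∀ n, Measurable (V n)) {ρ : ℝ → ℝ} (hρsupp : HasCompactSupport ρ)
    (hVlaw : ∀ n, P.map (V n) = volume.withDensity (fun x => ENNReal.ofReal (ρ x))) :
    ∃ R : ℝ, 0 ≤ R ∧ ∀ᵐ ω ∂P, ∀ n, |V n ω| ≤ R := by
  obtain ⟨R, hR⟩ := hρsupp.isCompact.isBounded.exists_norm_le
  refine ⟨max R 0, le_max_right _ _, ae_all_iff.2 fun n => ?_⟩
  have hs : MeasurableSet {x : ℝ | ¬ |x| ≤ max R 0} :=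
    (measurableSet_le measurable_norm measurable_const).compl
  have h0 : P.map (V n) {x : ℝ | ¬ |x| ≤ max R 0} = 0 := by
    rw [hVlaw, withDensity_apply _ hs]
    refine (setLIntegral_congr_fun hs fun x hx => ?_).trans (lintegral_zero)
    have hx' : x ∉ tsupport ρ := fun h => hx ((hR x h).trans (le_max_left _ _))
    simp [image_eq_zero_of_notMem_tsupport hx']
  rwa [Measure.map_apply (hVmeas n) hs] at h0

theorem withDensity_le_smul_volume {ρ : ℝ → ℝ} {K : ℝ} (hK : ∀ x, ρ x ≤ K) :
    volume.withDensity (fun x => ENNReal.ofReal (ρ x)) ≤ ENNReal.ofReal K • (volume : Measure ℝ) := by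
  rw [← withDensity_const]
  exact withDensity_mono (Eventually.of_forall fun x => ENNReal.ofReal_le_ofReal (hK x))

theorem tendsto_natCast_rpow_neg {γ : ℝ} (hγ : 0 < γ) :
    Tendsto (fun L : ℕ => (L : ℝ) ^ (-γ)) atTop (𝓝 0) :=
  (tendsto_rpow_neg_atTop hγ).comp tendsto_natCast_atTop_atTop

/-- With `y = (log L) ^ β` this is `y ^ (1/β) ≤ exp y` for large `y`. -/
theorem eventually_log_le_exp_log_rpow {β : ℝ} (hβ : 0 < β) :
    ∀ᶠ L : ℕ in atTop, Real.log L ≤ Real.exp (Real.log L ^ β) := by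
  have h1 : Tendsto (fun L : ℕ => Real.log (L : ℝ)) atTop atTop :=
    Real.tendsto_log_atTop.comp tendsto_natCast_atTop_atTop
  have h2 : Tendsto (fun L : ℕ => Real.log (L : ℝ) ^ β) atTop atTop :=
    (tendsto_rpow_atTop hβ).comp h1
  have h3 := h2.eventually ((isLittleO_rpow_exp_atTop β⁻¹).bound one_pos)
  filter_upwards [h3, h1.eventually_ge_atTop 0] with L hL hL0
  rw [← Real.rpow_mul hL0, mul_inv_cancel₀ hβ.ne', Real.rpow_one, one_mul, Real.norm_eq_abs,
    Real.norm_eq_abs, abs_of_nonneg hL0, abs_of_pos (Real.exp_pos _)] at hL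
  exact hL

/-- For large `L` one has `4 * l ≤ L ^ 2`. With `log 2 ≥ 1/2` the binary logarithm is at most `4 *
log L + 1`, and the `1` is absorbed by a fifth `log L`. -/
theorem eventually_clog_le {β α k : ℝ} (hβ : 0 < β) (hα1 : α < 1) :
    ∀ᶠ L : ℕ in atTop, ∀ l : ℕ, 1 ≤ l → (l : ℝ) ≤ (L : ℝ) ^ α / k →
      (Nat.clog 2 (4 * l) : ℝ) ≤ 5 * Real.exp (Real.log L ^ β) := by
  have h1 : Tendsto (fun L : ℕ => Real.log (L : ℝ)) atTop atTop :=
    Real.tendsto_log_atTop.comp tendsto_natCast_atTop_atTop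
  filter_upwards [eventually_log_le_exp_log_rpow hβ, h1.eventually_ge_atTop 1,
    tendsto_natCast_atTop_atTop.eventually_ge_atTop (4 / k), eventually_ge_atTop 1]
    with L hL1 hL2 hL3 hL4 l hl hlk
  have hL0 : (1 : ℝ) ≤ L := by exact_mod_cast hL4
  have h4l : (4 * l : ℝ) ≤ (L : ℝ) ^ 2 := by
    have h5 : (L : ℝ) ^ α ≤ L := by
      calc (L : ℝ) ^ α ≤ (L : ℝ) ^ (1 : ℝ) := Real.rpow_le_rpow_of_exponent_le hL0 hα1.le
        _ = L := Real.rpow_one _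
    calc (4 * l : ℝ) ≤ 4 * ((L : ℝ) ^ α / k) := by gcongr
      _ = 4 / k * (L : ℝ) ^ α := by ring
      _ ≤ L * L := by gcongr
      _ = _ := by ring
  have hlt := Nat.pow_pred_clog_lt_self (b := 2) (by norm_num) (x := 4 * l) (by omega)
  have hlt' : ((2 : ℝ)) ^ (Nat.clog 2 (4 * l)).pred ≤ (L : ℝ) ^ 2 := by
    refine le_trans ?_ h4l
    exact_mod_cast hlt.le
  have hlog := Real.log_le_log (by positivity) hlt'
  rw [Real.log_pow, Real.log_pow] at hlog
  have hlog2 : (1 / 2 : ℝ) ≤ Real.log 2 := by linarith [Real.log_two_gt_d9]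
  have hpred : (Nat.clog 2 (4 * l) : ℝ) ≤ (Nat.clog 2 (4 * l)).pred + 1 := by
    have : Nat.clog 2 (4 * l) ≤ (Nat.clog 2 (4 * l)).pred + 1 := by
      rw [Nat.pred_eq_sub_one]; omega
    exact_mod_cast this
  have hnn : (0 : ℝ) ≤ (Nat.clog 2 (4 * l)).pred := Nat.cast_nonneg _
  push_cast at hlog
  nlinarith

theorem one_le_mul_abs {H z : ℝ} (hz : z ≠ 0) (h : |z|⁻¹ ≤ H) : 1 ≤ H * |z| := by
  have := abs_pos.2 hz
  calc 1 = |z|⁻¹ * |z| := (inv_mul_cancel₀ this.ne').symm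
    _ ≤ H * |z| := by gcongr

/-- A constant that bounds the data of the problem and their inverses. -/
theorem exists_data_bound {a : ℤ → ℝ} {M : ℝ} (hM : 0 < M) (ha : ∀ n, 1 / M ≤ |a n| ∧ |a n| ≤ M)
    {lam lam' μ μ' : ℝ} (hlam : lam ≠ 0)
    (h : AtLeastTwoNonzero (lam + lam') (lam - lam') (μ - μ')) {R : ℝ} (hR : 0 ≤ R) :
    ∃ H : ℝ, 1 ≤ H ∧ (∀ n, |a n| ≤ H ∧ 1 ≤ H * |a n|) ∧ (|lam| ≤ H ∧ 1 ≤ H * |lam|) ∧ |lam'| ≤ H ∧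
      (|μ - μ'| ≤ H ∧ (μ - μ' ≠ 0 → 1 ≤ H * |μ - μ'|)) ∧
      (∀ t, t = lam' - lam ∨ t = -lam' - lam →
        |t| ≤ H ∧ (t ≠ 0 → 1 ≤ H * |t|) ∧ (t = 0 → μ - μ' ≠ 0)) ∧
      ∀ x, |x| ≤ R → |x - μ| ≤ H ∧ |x - μ'| ≤ H := by
  have hMi : ∀ n, 1 ≤ M * |a n| := fun n => by
    have := (ha n).1
    rwa [div_le_iff₀ hM, mul_comm] at this
  let t₁ := lam' - lam
  let t₂ := -lam' - lam
  let H := 1 + M + (|lam| + |lam|⁻¹) + |lam'| + (|μ - μ'| + |μ - μ'|⁻¹) + (|t₁| + |t₁|⁻¹) +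
    (|t₂| + |t₂|⁻¹) + (R + |μ|) + (R + |μ'|)
  have p1 := abs_nonneg lam
  have p2 := inv_nonneg.2 p1
  have p3 := abs_nonneg lam'
  have p4 := abs_nonneg (μ - μ')
  have p5 := inv_nonneg.2 p4
  have p6 := abs_nonneg t₁
  have p7 := inv_nonneg.2 p6
  have p8 := abs_nonneg t₂
  have p9 := inv_nonneg.2 p8
  have p10 := abs_nonneg μ
  have p11 := abs_nonneg μ'
  refine ⟨H, ?_, fun n => ⟨(ha n).2.trans ?_, (hMi n).trans ?_⟩, ⟨?_, one_le_mul_abs hlam ?_⟩, ?_,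
    ⟨?_, fun hz => one_le_mul_abs hz ?_⟩, ?_, fun x hx => ⟨(abs_sub _ _).trans ?_,
    (abs_sub _ _).trans ?_⟩⟩
  · simp only [H]; linarith
  · simp only [H]; linarith
  · gcongr; simp only [H]; linarith
  · simp only [H]; linarith
  · simp only [H]; linarith
  · simp only [H]; linarith
  · simp only [H]; linarith
  · simp only [H]; linarith
  · rintro t (rfl | rfl)
    · refine ⟨by simp only [H, t₁] at *; linarith, fun hz => one_le_mul_abs hz ?_, fun hz => ?_⟩
      · simp only [H, t₁] at *; linarith
      -- If one of `lam ± lam'` vanishes, the other two of the three numbers are non-zero.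
      · have hb : lam - lam' = 0 := by linarith
        rcases h with h | h | h
        exacts [absurd hb h.2, h.2, h.2]
    · refine ⟨by simp only [H, t₂] at *; linarith, fun hz => one_le_mul_abs hz ?_, fun hz => ?_⟩
      · simp only [H, t₂] at *; linarith
      · have hd : lam + lam' = 0 := by linarith
        rcases h with h | h | h
        exacts [absurd hd h.1, h.2, h.2]
  · simp only [H]; linarith
  · simp only [H]; linarith

theorem mem_Icc_of_abs_le {lam μ e Λ : ℝ} {L : ℕ} (hΛ : |lam| ≤ Λ)
    (he : e ∈ Set.Icc (-(L : ℝ)⁻¹) (L : ℝ)⁻¹) :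
    μ + lam * e ∈ Set.Icc (μ - Λ / L) (μ + Λ / L) := by
  have h1 : |lam * e| ≤ Λ / L := by
    rw [abs_mul, div_eq_mul_inv]
    gcongr
    · exact (abs_nonneg _).trans hΛ
    · exact abs_le.2 he
  rw [abs_le] at h1
  constructor <;> linarith [h1.1, h1.2]

theorem wegner_final_bound {l L Q k Λ k₀ X : ℝ} (hl : 0 ≤ l) (hL : 0 < L) (hk₀ : 0 < k₀)
    (hk : 0 ≤ k) (hΛ : 0 ≤ Λ) (hX : 0 ≤ X) (hlow : k₀ * L ^ (1 / 3 : ℝ) ≤ l) (hQ : Q ≤ 5 * X) :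
    4 * (Q * (l * (k * (2 * (Λ / L))))) ≤ 40 * k * Λ / k₀ * (l ^ 2 / L ^ (4 / 3 : ℝ)) * X := by
  have e1 : L ^ (4 / 3 : ℝ) = L ^ (1 / 3 : ℝ) * L := by
    nth_rewrite 3 [← Real.rpow_one L]
    rw [← Real.rpow_add hL]; norm_num
  have h13 : 0 < L ^ (1 / 3 : ℝ) := by positivity
  calc 4 * (Q * (l * (k * (2 * (Λ / L))))) ≤ 4 * (5 * X * (l * (k * (2 * (Λ / L))))) := by gcongr
    _ = 40 * k * Λ / k₀ * (k₀ * L ^ (1 / 3 : ℝ) * l / (L ^ (1 / 3 : ℝ) * L)) * X := by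
      field_simp; ring
    _ ≤ 40 * k * Λ / k₀ * (l * l / (L ^ (1 / 3 : ℝ) * L)) * X := by gcongr
    _ = _ := by rw [e1, pow_two]

/-- In the first summand the exponents add up to `2α + 2γ - 2 = -4/3`. In the second, the grid's
`1/κ` uses up one of the `w + 1` factors `κ`; the others give `κ ^ w ≤ L^(-4/3)`, and `l ≤ l ^ 2`.
-/
theorem decorrelation_final_bound {l L k Λ k₀ α γ H D κ c : ℝ} {w : ℕ} (hl : 1 ≤ l) (hL : 1 ≤ L)
    (hH : 1 ≤ H) (hD : 0 ≤ D) (hc : 0 ≤ c)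
    (hγ : γ = 1 / 3 - α) (hw : 4 / 3 ≤ γ * w) (hκ : κ = L ^ (-γ)) (hup : l ≤ L ^ α / k₀) :
    l ^ 2 * (k * (k * (2 * (l ^ 2 / κ ^ 2 * (2 * (Λ / L) * (2 * (Λ / L))))))) +
      2 * l * (c * (6 / (6 * H ^ 2 * κ) * (D * (6 * H ^ 2 * κ)) ^ (w + 1))) ≤
    (8 * k ^ 2 * Λ ^ 2 / k₀ ^ 2 + 2 * c * (D ^ (w + 1) * 6 * (6 * H ^ 2) ^ w)) *
      (l ^ 2 / L ^ (4 / 3 : ℝ)) := by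
  have hL0 : 0 < L := by linarith
  have hκ0 : 0 < κ := by rw [hκ]; positivity
  have hL43 : 0 < L ^ (4 / 3 : ℝ) := by positivity
  rw [add_mul]
  refine add_le_add ?_ ?_
  · have e1 : (L ^ α) ^ 2 / κ ^ 2 / L ^ 2 = 1 / L ^ (4 / 3 : ℝ) := by
      rw [hκ, ← Real.rpow_natCast, ← Real.rpow_natCast, ← Real.rpow_natCast, ← Real.rpow_mul hL0.le,
        ← Real.rpow_mul hL0.le, ← Real.rpow_sub hL0, ← Real.rpow_sub hL0, one_div,
        ← Real.rpow_neg hL0.le]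
      congr 1
      rw [hγ]; push_cast; ring
    calc l ^ 2 * (k * (k * (2 * (l ^ 2 / κ ^ 2 * (2 * (Λ / L) * (2 * (Λ / L)))))))
        = 8 * k ^ 2 * Λ ^ 2 * l ^ 2 * (l ^ 2 / κ ^ 2 / L ^ 2) := by ring
      _ ≤ 8 * k ^ 2 * Λ ^ 2 * l ^ 2 * ((L ^ α / k₀) ^ 2 / κ ^ 2 / L ^ 2) := by gcongr
      _ = 8 * k ^ 2 * Λ ^ 2 / k₀ ^ 2 * l ^ 2 * ((L ^ α) ^ 2 / κ ^ 2 / L ^ 2) := by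
        rw [div_pow]; ring
      _ = _ := by rw [e1]; ring
  · have hκw : κ ^ w ≤ 1 / L ^ (4 / 3 : ℝ) := by
      rw [hκ, ← Real.rpow_natCast, ← Real.rpow_mul hL0.le, one_div, ← Real.rpow_neg hL0.le]
      exact Real.rpow_le_rpow_of_exponent_le hL (by linarith)
    calc 2 * l * (c * (6 / (6 * H ^ 2 * κ) * (D * (6 * H ^ 2 * κ)) ^ (w + 1)))
        = 2 * c * (D ^ (w + 1) * 6 * (6 * H ^ 2) ^ w) * (l * κ ^ w) := by
          have hH0 : H ≠ 0 := by positivity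
          rw [mul_pow D, pow_succ (6 * H ^ 2 * κ), mul_pow (6 * H ^ 2) κ w]
          field_simp
      _ ≤ 2 * c * (D ^ (w + 1) * 6 * (6 * H ^ 2) ^ w) * (l ^ 2 * (1 / L ^ (4 / 3 : ℝ))) := by
        gcongr
        nlinarith
      _ = _ := by ring

end RandomJacobi

end

/-! ### Conclusion -/

theorem mainTheorem2
    {Ω : Type*} [MeasurableSpace Ω] (P : Measure Ω) [IsProbabilityMeasure P]
    -- the deterministic hopping terms
    (a : ℤ → ℝ) (M : ℝ) (hM : 0 < M) (ha : ∀ n, 1 / M ≤ |a n| ∧ |a n| ≤ M)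
    -- the i.i.d. potential, with a bounded, compactly supported density
    (V : ℤ → Ω → ℝ) (hVmeas : ∀ n, Measurable (V n)) (hVindep : iIndepFun V P)
    (ρ : ℝ → ℝ) (hρmeas : Measurable ρ) (hρnonneg : ∀ x, 0 ≤ ρ x)
    (hρbdd : ∃ K, ∀ x, ρ x ≤ K) (hρsupp : HasCompactSupport ρ)
    (hVlaw : ∀ n, P.map (V n) = volume.withDensity (fun x => ENNReal.ofReal (ρ x)))
    (lam mu : ℝ → ℝ) (β : ℝ) (hβ : β ∈ Set.Ioo (1 / 2 : ℝ) 1)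
    (α : ℝ) (hα : α ∈ Set.Ioo (0 : ℝ) 1)
    (E E' : ℝ) (hE : E ∈ RandomJacobi.energySet lam) (hE' : E' ∈ RandomJacobi.energySet lam)
    (hdbc : RandomJacobi.AtLeastTwoNonzero (lam E + lam E') (lam E - lam E') (mu E - mu E'))
    (k : ℝ) (hk : 0 < k) :
    ∃ C : ℝ, 0 < C ∧ ∀ᶠ L : ℕ in atTop, ∀ l : ℕ,
      k * (L : ℝ) ^ α ≤ (l : ℝ) → (l : ℝ) ≤ (L : ℝ) ^ α / k →
        P.real {ω |
          RandomJacobi.trSpectralProj a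
              (RandomJacobi.potentialAt lam mu E (fun n => V n ω)) l
              (Set.Icc (-(L : ℝ)⁻¹) (L : ℝ)⁻¹) ≠ 0 ∧
          RandomJacobi.trSpectralProj a
              (RandomJacobi.potentialAt lam mu E' (fun n => V n ω)) l
              (Set.Icc (-(L : ℝ)⁻¹) (L : ℝ)⁻¹) ≠ 0}
          ≤ C * ((l : ℝ) ^ 2 / (L : ℝ) ^ (4 / 3 : ℝ)) * Real.exp (Real.log L ^ β) := by
  open RandomJacobi in
  have hE0 : lam E ≠ 0 := hE
  have hE0' : lam E' ≠ 0 := hE'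
  have hβ0 : 0 < β := by linarith [hβ.1]
  obtain ⟨K, hK⟩ := hρbdd
  have hK0 : 0 ≤ K := (hρnonneg 0).trans (hK 0)
  obtain ⟨R, hR0, hR⟩ := ae_abs_le_of_hasCompactSupport hVmeas hρsupp hVlaw
  obtain ⟨H, hH, haH, hlamH, hlamH', hgap, hlink, hVH⟩ :=
    exists_data_bound hM ha hE0 hdbc hR0
  set ν : Measure ℝ := P.map (V 0) with hν
  have hνp : IsProbabilityMeasure ν := Measure.isProbabilityMeasure_map (hVmeas 0).aemeasurable
  have hlaw : ∀ n, P.map (V n) = ν := fun n => by rw [hν, hVlaw, hVlaw]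
  have hνK : ν ≤ ENNReal.ofReal K • volume := by
    rw [hν, hVlaw]; exact withDensity_le_smul_volume hK
  have ha0 : ∀ n, a n ≠ 0 := fun n hz => by have := (haH n).2; rw [hz] at this; norm_num at this
  set Λ := max |lam E| |lam E'| with hΛ
  have hΛ0 : 0 < Λ := lt_max_of_lt_left (abs_pos.2 hE0)
  have hev1 : ∀ᶠ L : ℕ in atTop, (1 : ℝ) ≤ L :=
    tendsto_natCast_atTop_atTop.eventually_ge_atTop 1
  rcases le_or_gt (1 / 3) α with hα3 | hα3
  -- For `α ≥ 1/3` the condition at `E'` is dropped and the Wegner estimate at `E` suffices.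
  · refine ⟨40 * K * Λ / k + 1, by positivity, ?_⟩
    filter_upwards [hev1, eventually_clog_le (k := k) hβ0 hα.2] with L hL hclog l hl1 hl2
    have hL0 : (0 : ℝ) < L := by linarith
    have hlpos : (0 : ℝ) < l := lt_of_lt_of_le (by positivity) hl1
    have hl1' : 1 ≤ l := by exact_mod_cast hlpos
    have hX := Real.exp_pos (Real.log L ^ β)
    have hlow : k * (L : ℝ) ^ (1 / 3 : ℝ) ≤ l := by
      refine le_trans ?_ hl1
      gcongr
    have hfin := wegner_final_bound hlpos.le hL0 hk hK0 hΛ0.le hX.le hlow (hclog l hl1' hl2)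
    refine le_trans (ENNReal.toReal_le_of_le_ofReal (by positivity) ?_) (hfin.trans ?_)
    · calc _ ≤ P {ω | (fun n : Box l => V n ω) ∈ {v : Box l → ℝ | ∃ e ∈ Set.Icc (mu E - Λ / L)
            (mu E + Λ / L), ∃ φ, IsEigenpair (hopMatrix a (lam E) l) v e φ}} := by
            refine measure_mono fun ω hω => ?_
            obtain ⟨e, he, φ, hφ⟩ := exists_isEigenpair_of_trSpectralProj_ne_zero hE0 hω.1
            exact ⟨_, mem_Icc_of_abs_le (le_max_left _ _) he, φ, hφ⟩
        _ ≤ _ := measure_mem_le_pi hVmeas hVindep hlaw l _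
        _ ≤ _ := pi_eigenpair_le (hopMatrix_isHermitian a (lam E) l)
            (simpleKernel_hopMatrix ha0 hE0 l) ν hνK _ _ (Q := Nat.clog 2 (4 * l))
            (by rw [card_box]; exact Nat.le_pow_clog (by norm_num) _)
        _ = _ := by
          have e1 : mu E + Λ / L - (mu E - Λ / L) = 2 * (Λ / L) := by ring
          rw [e1, card_box, ENNReal.ofReal_mul (p := 4) (by norm_num),
            ENNReal.ofReal_mul (p := (Nat.clog 2 (4 * l) : ℝ)) (by positivity),
            ENNReal.ofReal_mul (p := (l : ℝ)) (by positivity), ENNReal.ofReal_mul (p := K) hK0]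
          simp
    · gcongr
      linarith
  · set γ : ℝ := 1 / 3 - α with hγ
    have hγ0 : 0 < γ := by linarith
    have hγ1 : γ < 1 := by linarith [hα.1]
    -- The number of blocks is fixed before `L`, so all constants depending on it are harmless.
    -- Below `w + 1` blocks are used, the extra one paying for the grid of initial values.
    obtain ⟨w, hw⟩ := exists_nat_ge (4 / 3 / γ)
    rw [div_le_iff₀ hγ0, mul_comm] at hw
    set D : ℝ := 6 * K * (4 * (3 * H ^ 4) ^ (3 * (w + 1) + 1)) ^ 2 with hD
    have hD0 : 0 ≤ D := by positivity
    set c : ℝ := 2 ^ (3 * (w + 1) + 1) with hc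
    have hc0 : 0 < c := by positivity
    set C : ℝ := 8 * K ^ 2 * Λ ^ 2 / k ^ 2 + 2 * c * (D ^ (w + 1) * 6 * (6 * H ^ 2) ^ w) with hC
    have hC0 : 0 ≤ C := by positivity
    have hκt := tendsto_natCast_rpow_neg hγ0
    have hsmall : ∀ B : ℝ, ∀ᶠ L : ℕ in atTop, B * (L : ℝ) ^ (-γ) ≤ 1 := fun B => by
      have := (hκt.const_mul B)
      rw [mul_zero] at this
      exact (this.eventually_lt_const one_pos).mono fun _ h => h.le
    have hεκ : ∀ᶠ L : ℕ in atTop, Λ * (L : ℝ) ^ (-(1 - γ)) ≤ 1 := by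
      have := ((tendsto_natCast_rpow_neg (γ := 1 - γ) (by linarith)).const_mul Λ)
      rw [mul_zero] at this
      exact (this.eventually_lt_const one_pos).mono fun _ h => h.le
    have hlbig : ∀ᶠ L : ℕ in atTop, ((2 * (3 * (w + 1) + 2) : ℕ) : ℝ) ≤ k * (L : ℝ) ^ α :=
      (((tendsto_rpow_atTop hα.1).comp tendsto_natCast_atTop_atTop).const_mul_atTop
        hk).eventually_ge_atTop _
    have hlog : ∀ᶠ L : ℕ in atTop, 0 ≤ Real.log (L : ℝ) ^ β := by
      filter_upwards [hev1] with L hL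
      exact Real.rpow_nonneg (Real.log_nonneg hL) _
    refine ⟨C + 1, by positivity, ?_⟩
    filter_upwards [hev1, hsmall (6 * H ^ 2),
      hsmall (6 * H ^ 2 * (4 * (3 * H ^ 4) ^ (2 * (3 * (w + 1)) + 2))), hεκ, hlbig, hlog]
      with L hL hs1 hs2 hs3 hlb hlg l hl1 hl2
    have hL0 : (0 : ℝ) < L := by linarith
    have hlN : 2 * (3 * (w + 1) + 2) ≤ l := by exact_mod_cast hlb.trans hl1
    have hl1' : (1 : ℝ) ≤ l := by exact_mod_cast (by omega : 1 ≤ l)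
    have hle : Λ / L ≤ (L : ℝ) ^ (-γ) := by
      have e1 : Λ / L = Λ * (L : ℝ) ^ (-(1 - γ)) * (L : ℝ) ^ (-γ) := by
        rw [mul_assoc, ← Real.rpow_add hL0, div_eq_mul_inv, ← Real.rpow_neg_one]
        congr 2; ring
      rw [e1]
      exact mul_le_of_le_one_left (by positivity) hs3
    have hpi := pi_eigenpairs_le (a := a) (lam := lam E) (lam' := lam E') hH haH hlamH hlamH' hE0'
      hgap hlink ν hK0 hνK (κ := (L : ℝ) ^ (-γ)) (ε := Λ / L) (by positivity) hle hs1 (w := w + 1)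
      (le_trans (le_of_eq (by ring)) hs2) (l := l) hlN
    have hfin := decorrelation_final_bound (k := K) (Λ := Λ) (D := D) (c := c) hl1' hL hH hD0
      hc0.le hγ hw rfl hl2
    refine le_trans (ENNReal.toReal_le_of_le_ofReal (by positivity) ?_) (hfin.trans ?_)
    · refine le_trans ?_ hpi
      refine le_trans ?_ (measure_mem_le_pi hVmeas hVindep hlaw l _)
      -- The bound on the potential, needed for the chains, holds only almost surely.
      refine measure_mono_ae ?_
      filter_upwards [hR] with ω hω hmem
      refine ⟨fun n => hVH _ (hω n), ?_, ?_⟩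
      · obtain ⟨e, he, φ, hφ⟩ := exists_isEigenpair_of_trSpectralProj_ne_zero hE0 hmem.1
        exact ⟨_, mem_Icc_of_abs_le (le_max_left _ _) he, φ, hφ⟩
      · obtain ⟨e, he, φ, hφ⟩ := exists_isEigenpair_of_trSpectralProj_ne_zero hE0' hmem.2
        exact ⟨_, mem_Icc_of_abs_le (le_max_right _ _) he, φ, hφ⟩
    · have hexp : 1 ≤ Real.exp (Real.log L ^ β) := Real.one_le_exp hlg
      have hq : 0 ≤ (l : ℝ) ^ 2 / (L : ℝ) ^ (4 / 3 : ℝ) := by positivity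
      calc C * ((l : ℝ) ^ 2 / (L : ℝ) ^ (4 / 3 : ℝ))
          ≤ (C + 1) * ((l : ℝ) ^ 2 / (L : ℝ) ^ (4 / 3 : ℝ)) := by gcongr; linarith
        _ ≤ _ := le_mul_of_one_le_right (by positivity) hexp
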